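/- Let $d\ge 3$. Let $V:\mathbb R^d\to[0,\infty)$ be locally integrable, not almost everywhere zero, and in the reverse Hölder class $RH_s$ for some $s\in[d/2,\infty]$, i.e. $\big(\frac1{|B|}\int_B V^s\big)^{1/s}\le \frac{C}{|B|}\int_B V$ for all balls $B$ (with $\operatorname{ess\,sup}_B V$ on the left if $s=\infty$). Let $$\rho(x)=\sup\Big\{r>0:\ r^{2-d}\int_{B(x,r)}V\le 1\Big\}$$ be its critical radius function. Let $Q(x_0,r)$ denote the cube with centre $x_0$, side length $r$ and sides parallel to the axes. For $\theta>0$, a locally integrable $f:\mathbb R^d\to\mathbb R$ belongs to $\mathrm{BLO}_{\rho,\theta}$ if $$\|f\|_{\mathrm{BLO}_{\rho,\theta}}=\sup_{Q=Q(x_0,r)}\Big(1+\frac r{\rho(x_0)}\Big)^{-\theta}\frac1{|Q|}\int_Q\big[f-\operatorname*{ess\,inf}_Q f\big]\,dx<\infty .$$ A weight is a nonnegative locally integrable function on $\mathbb R^d$ that is not almost everywhere zero; write $\omega^\gamma(E)=\int_E\omega^\gamma\,dx$. For $1\le p<q<\infty$, a weight $\omega$ is in $A_{p,q}^{\rho,\theta}$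 if $[\omega]_{A_{p,q}^{\rho,\theta}}<\infty$, where $$[\omega]_{A_{p,q}^{\rho,\theta}}=\sup_{B=B(x_0,r)}\Big(1+\frac r{\rho(x_0)}\Big)^{-\theta}\Big(\frac1{|B|}\int_B\omega^q\Big)^{1/q}\Big(\frac1{|B|}\int_B\omega^{-p'}\Big)^{1/p'},\qquad p'=\frac p{p-1},$$ with the last factor replaced by $(\operatorname{ess\,inf}_B\omega)^{-1}$ if $p=1$. Fix $1\le p<q<\infty$ and $\theta_1,\theta_2>0$, and let $\omega\in A_{p,q}^{\rho,\theta_2}$. Consider constants $C_0\ge1$, $N_0>0$ such that for all $x,y\in\mathbb R^d$ $$\frac1{C_0}\Big(1+\frac{|x-y|}{\rho(x)}\Big)^{-N_0}\le\frac{\rho(y)}{\rho(x)}\le C_0\Big(1+\frac{|x-y|}{\rho(x)}\Big)^{N_0/(N_0+1)},\tag{a}$$ and constants $\delta\in(0,1)$, $\eta>1$, $K>0$ such that for every cube $Q=Q(x_0,r)$ and every measurable $E\subset Q$ $$\frac{\omega^q(E)}{\omega^q(Q)}\le K\Big(\frac{|E|}{|Q|}\Big)^{\delta}\Big(1+\frac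 r{\rho(x_0)}\Big)^{\eta}.\tag{b}$$ Constants as in (a) and constants as in (b) exist. For every choice of such constants the following holds. 1. There is a constant $C>0$, depending only on $d,p,q,\theta_1,\theta_2,C_0,N_0,\delta,\eta,K$, such that for every $f\in\mathrm{BLO}_{\rho,\theta_1}$ and every cube $Q=Q(x_0,r)$ $$\frac{|Q|^{1/p-1/q}}{[\omega^p(Q)]^{1/p}}\Big(\int_Q\big[f-\operatorname*{ess\,inf}_Qf\big]^q\omega^q\,dx\Big)^{1/q}\le C\,[\omega]_{A_{p,q}^{\rho,\theta_2}}\Big(1+\frac r{\rho(x_0)}\Big)^{(N_0+1)\theta_1+\theta_2+\eta/q}\|f\|_{\mathrm{BLO}_{\rho,\theta_1}}.$$ 2. Conversely, let $C>0$ and let $f:\mathbb R^d\to\mathbb R$ be a Lebesgue measurable function such that for every cube $Q=Q(x_0,r)$ $$\frac{|Q|^{1/p-1/q}}{[\omega^p(Q)]^{1/p}}\Big(\int_Q\big[f-\operatorname*{ess\,inf}_Qf\big]^q\omega^q\,dx\Big)^{1/q}\le C\,[\omega]_{A_{p,q}^{\rho,\theta_2}}\Big(1+\frac r{\rho(x_0)}\Big)^{\theta_1-\theta_2}.$$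 Then $f\in\mathrm{BLO}_{\rho,\theta_1}$ and $\|f\|_{\mathrm{BLO}_{\rho,\theta_1}}\le C'\,[\omega]_{A_{p,q}^{\rho,\theta_2}}$, where $C'>0$ depends only on $d,p,q,\theta_1,\theta_2$, $C$ and an upper bound for $[\omega]_{A_{p,q}^{\rho,\theta_2}}$. -/

import Mathlib

open MeasureTheory
open scoped ENNReal

noncomputable section

namespace SchrodingerBLO

variable {d : ℕ}

/-- The reverse Hölder class `RH_s`, `s ∈ (1, ∞]`. For finite `s` the `L^s` norm with respect to
normalized Lebesgue measure on `B` is `(|B|⁻¹ ∫_B V^s)^{1/s}`; for `s = ∞` it is the essential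
supremum over `B`. -/
def ReverseHolder (s : ℝ≥0∞) (V : EuclideanSpace ℝ (Fin d) → ℝ) : Prop :=
  ∃ C : ℝ, 0 < C ∧ ∀ (x : EuclideanSpace ℝ (Fin d)) (r : ℝ), 0 < r →
    eLpNorm V s ((volume (Metric.ball x r))⁻¹ • volume.restrict (Metric.ball x r)) ≤
      ENNReal.ofReal C * ⨍⁻ y in Metric.ball x r, ENNReal.ofReal (V y) ∂volume

/-- The admissible potentials: nonnegative, locally integrable, not (almost everywhere) zero, and
in `RH_s` for some `s ∈ [d/2, ∞]`. -/
structure IsPotential (V : EuclideanSpace ℝ (Fin d) → ℝ) : Prop where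
  nonneg : ∀ x, 0 ≤ V x
  locallyIntegrable : LocallyIntegrable V volume
  ne_zero : ¬ V =ᵐ[volume] 0
  reverseHolder : ∃ s : ℝ≥0∞, (d : ℝ≥0∞) / 2 ≤ s ∧ ReverseHolder s V

/-- The critical radius function
`ρ(x) = sup {r > 0 : r^{-(d-2)} ∫_{B(x,r)} V ≤ 1}` (used for `d ≥ 3`). -/
def criticalRadius (V : EuclideanSpace ℝ (Fin d) → ℝ) (x : EuclideanSpace ℝ (Fin d)) : ℝ :=
  sSup {r : ℝ | 0 < r ∧ 1 / r ^ (d - 2) * ∫ y in Metric.ball x r, V y ≤ 1}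

/-- The cube `Q(x₀, r)` with centre `x₀`, side length `r` and sides parallel to the axes. -/
def cube (x₀ : EuclideanSpace ℝ (Fin d)) (r : ℝ) : Set (EuclideanSpace ℝ (Fin d)) :=
  {y | ∀ i, |y i - x₀ i| ≤ r / 2}

/-- The function `f(x) - ess inf_{y ∈ S} f(y)` with values in `[0, ∞]`. The essential infimum is
taken in the extended reals, so the value is `∞` if `f` is not essentially bounded below on `S`. -/
def lowerOsc (f : EuclideanSpace ℝ (Fin d) → ℝ) (S : Set (EuclideanSpace ℝ (Fin d)))
    (x : EuclideanSpace ℝ (Fin d)) : ℝ≥0∞ :=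
  ((f x : EReal) - essInf (fun y => (f y : EReal)) (volume.restrict S)).toENNReal

/-- The constant `‖f‖_{BLO_{ρ,θ}}`. -/
def bloConst (ρ : EuclideanSpace ℝ (Fin d) → ℝ) (θ : ℝ)
    (f : EuclideanSpace ℝ (Fin d) → ℝ) : ℝ≥0∞ :=
  ⨆ (x₀ : EuclideanSpace ℝ (Fin d)) (r : ℝ) (_ : 0 < r),
    ENNReal.ofReal ((1 + r / ρ x₀) ^ (-θ)) * ⨍⁻ x in cube x₀ r, lowerOsc f (cube x₀ r) x ∂volume

/-- Membership in `BLO_{ρ,θ}`. -/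
def MemBLO (ρ : EuclideanSpace ℝ (Fin d) → ℝ) (θ : ℝ)
    (f : EuclideanSpace ℝ (Fin d) → ℝ) : Prop :=
  LocallyIntegrable f volume ∧ bloConst ρ θ f < ∞

/-- `ω^γ(E) = ∫_E ω(x)^γ dx`. -/
def weightPow (ω : EuclideanSpace ℝ (Fin d) → ℝ) (γ : ℝ)
    (E : Set (EuclideanSpace ℝ (Fin d))) : ℝ≥0∞ :=
  ∫⁻ x in E, ENNReal.ofReal (ω x) ^ γ

/-- A weight: nonnegative, locally integrable, and not the zero weight. -/
structure IsWeight (ω : EuclideanSpace ℝ (Fin d) → ℝ) : Prop where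
  nonneg : ∀ x, 0 ≤ ω x
  locallyIntegrable : LocallyIntegrable ω volume
  ne_zero : ¬ ω =ᵐ[volume] 0

/-- The characteristic constant `[ω]_{A_{p,q}^{ρ,θ}}`, with `p' = p / (p - 1)` for `p > 1`. Negative
powers of `0` are `∞`. -/
def apqConst (ρ : EuclideanSpace ℝ (Fin d) → ℝ) (θ p q : ℝ)
    (ω : EuclideanSpace ℝ (Fin d) → ℝ) : ℝ≥0∞ :=
  ⨆ (x₀ : EuclideanSpace ℝ (Fin d)) (r : ℝ) (_ : 0 < r),
    ENNReal.ofReal ((1 + r / ρ x₀) ^ (-θ)) *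
      (⨍⁻ x in Metric.ball x₀ r, ENNReal.ofReal (ω x) ^ q ∂volume) ^ (1 / q) *
      (if p = 1 then
        (essInf (fun x => ENNReal.ofReal (ω x)) (volume.restrict (Metric.ball x₀ r)))⁻¹
      else
        (⨍⁻ x in Metric.ball x₀ r, ENNReal.ofReal (ω x) ^ (-(p / (p - 1))) ∂volume) ^
          (1 / (p / (p - 1))))

/-- The class `A_{p,q}^{ρ,θ}`. -/
def MemApq (ρ : EuclideanSpace ℝ (Fin d) → ℝ) (θ p q : ℝ)
    (ω : EuclideanSpace ℝ (Fin d) → ℝ) : Prop :=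
  IsWeight ω ∧ apqConst ρ θ p q ω < ∞

/-- `C₀ ≥ 1` and `N₀ > 0` are constants in the slow-variation inequality for `ρ`. -/
def SlowVariation (ρ : EuclideanSpace ℝ (Fin d) → ℝ) (C₀ N₀ : ℝ) : Prop :=
  1 ≤ C₀ ∧ 0 < N₀ ∧ ∀ x y : EuclideanSpace ℝ (Fin d),
    1 / C₀ * (1 + ‖x - y‖ / ρ x) ^ (-N₀) ≤ ρ y / ρ x ∧
    ρ y / ρ x ≤ C₀ * (1 + ‖x - y‖ / ρ x) ^ (N₀ / (N₀ + 1))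

/-- `δ ∈ (0, 1)`, `η > 1` and `K > 0` are constants in the comparison, over every cube `Q` and
every measurable `E ⊆ Q`, of the weighted measure `ω^γ` with Lebesgue measure. -/
def WeightComparison (ρ : EuclideanSpace ℝ (Fin d) → ℝ) (ω : EuclideanSpace ℝ (Fin d) → ℝ)
    (γ δ η K : ℝ) : Prop :=
  0 < δ ∧ δ < 1 ∧ 1 < η ∧ 0 < K ∧
  ∀ (x₀ : EuclideanSpace ℝ (Fin d)) (r : ℝ), 0 < r →
    ∀ E : Set (EuclideanSpace ℝ (Fin d)), MeasurableSet E → E ⊆ cube x₀ r →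
      weightPow ω γ E / weightPow ω γ (cube x₀ r) ≤
        ENNReal.ofReal K * (volume E / volume (cube x₀ r)) ^ δ *
          ENNReal.ofReal ((1 + r / ρ x₀) ^ η)

/-- The quantity
`|Q|^{1/p-1/q} (ω^p(Q))^{-1/p} (∫_Q [f - ess inf_Q f]^q ω^q)^{1/q}`. -/
def weightedOsc (p q : ℝ) (ω f : EuclideanSpace ℝ (Fin d) → ℝ)
    (Q : Set (EuclideanSpace ℝ (Fin d))) : ℝ≥0∞ :=
  volume Q ^ (1 / p - 1 / q) / weightPow ω p Q ^ (1 / p) *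
    (∫⁻ x in Q, lowerOsc f Q x ^ q * ENNReal.ofReal (ω x) ^ q) ^ (1 / q)

end SchrodingerBLO

end

/-! Both inequalities rest on one use of Hölder, `MemApq.setLIntegral_mul_le`: write G = (Gω)ω⁻¹ and
control ω⁻¹ by the A_{p,q} condition on a ball containing the cube. This costs one factor [ω] and
one factor (1 + r/ρ)^θ₂.

Converse: take G = f - ess inf f and pass from L^p to L^q on the cube. The exponent θ₁ - θ₂ of the
hypothesis is what the loss θ₂ turns into θ₁. One of the two resulting factors [ω] goes into the
constant.

Forward bound: G = 1 bounds ω^q(Q)^{1/q} by ω^p(Q)^{1/p}, so it remains to estimate the L^q(ω^q)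
norm of f - ess inf f by ω^q(Q)^{1/q}. By slow variation, 1 + s/ρ(x) ≲ (1 + r/ρ(x₀))^{N₀+1} for all
subcubes Q(x,s) of Q. Hence f is an ordinary BLO function inside Q, with constant about ‖f‖ (1 +
r/ρ(x₀))^{(N₀+1)θ₁}. A Calderón–Zygmund iteration (`volume_lowerOsc_gt_le`) gives exponential decay
of its level sets, (b) carries the decay over to ω^q with loss (1 + r/ρ)^η, and summing over levels
and taking a q-th root leaves η/q.

Existence of (a): let m(B) = ∫_B V^{d/2}. Reverse Hölder and Hölder make r^{2-d}∫_B V comparable to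
m(B)^{2/d}. The measure m is doubling, hence reverse doubling, so it grows at least like a power of
the radius. This supplies the decay at small scales even at the endpoint s = d/2, without improving
the reverse Hölder exponent. Slow variation follows in `slowVariation_of_doubling`.

Existence of (b): on cubes of side at most ρ the A_{p,q} condition is an A_∞ condition with a
uniform constant, and iterated Calderón–Zygmund decompositions turn it into a power bound
(`exists_measure_le_rpow_mul`). A larger cube is cut into dyadic pieces below the critical scale,
whose number is a power of 1 + r/ρ. -/

namespace SchrodingerBLO

/-! ### Cubes, dyadic grids and the Calderón–Zygmund decomposition. -/

section Cubes

open Set Filter Topology Metric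

variable {d : ℕ}

local notation "Eu" => EuclideanSpace ℝ (Fin d)

theorem norm_le_of_abs_apply_le {z : Eu} {t : ℝ} (ht : 0 ≤ t) (h : ∀ i, |z i| ≤ t) :
    ‖z‖ ≤ d * t := by
  rw [EuclideanSpace.norm_eq]
  apply Real.sqrt_le_iff.2
  refine ⟨by positivity, ?_⟩
  calc ∑ i, ‖z i‖ ^ 2 ≤ ∑ _i : Fin d, t ^ 2 := by
        gcongr with i
        exact h i
    _ = d * t ^ 2 := by simp
    _ ≤ (d * t) ^ 2 := by
        rcases Nat.eq_zero_or_pos d with h0 | h0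
        · simp [h0]
        · have : (1 : ℝ) ≤ d := by exact_mod_cast h0
          nlinarith [sq_nonneg t, mul_nonneg (by linarith : (0:ℝ) ≤ d) (sq_nonneg t)]

theorem abs_apply_le_norm (z : Eu) (i : Fin d) : |z i| ≤ ‖z‖ := by
  simpa using PiLp.norm_apply_le z i

/-- The half-open cube with centre `c` and side length `r`. -/
def hcube (c : Eu) (r : ℝ) : Set Eu := {y | ∀ i, c i - r / 2 ≤ y i ∧ y i < c i + r / 2}

theorem cube_eq_preimage (c : Eu) (r : ℝ) :
    cube c r = WithLp.ofLp ⁻¹' (Icc (fun i => c i - r / 2) (fun i => c i + r / 2)) := by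
  ext y
  simp only [cube, mem_ofPred_eq, mem_preimage, mem_Icc, Pi.le_def, abs_le]
  rw [← forall_and]
  refine forall_congr' fun i => ?_
  constructor <;> rintro ⟨h1, h2⟩ <;> constructor <;> linarith

theorem hcube_eq_preimage (c : Eu) (r : ℝ) :
    hcube c r = WithLp.ofLp ⁻¹' (pi univ fun i => Ico (c i - r / 2) (c i + r / 2)) := by
  ext y
  simp [hcube]

theorem isClosed_cube (c : Eu) (r : ℝ) : IsClosed (cube c r) := by
  rw [cube_eq_preimage]
  exact isClosed_Icc.preimage (PiLp.continuous_ofLp 2 _)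

theorem measurableSet_cube (c : Eu) (r : ℝ) : MeasurableSet (cube c r) :=
  (isClosed_cube c r).measurableSet

theorem measurableSet_hcube (c : Eu) (r : ℝ) : MeasurableSet (hcube c r) := by
  rw [hcube_eq_preimage]
  exact (PiLp.volume_preserving_ofLp (Fin d)).measurable
    (MeasurableSet.univ_pi fun i => measurableSet_Ico)

theorem volume_cube (c : Eu) (r : ℝ) : volume (cube c r) = ENNReal.ofReal r ^ d := by
  rw [cube_eq_preimage, (PiLp.volume_preserving_ofLp (Fin d)).measure_preimage
    measurableSet_Icc.nullMeasurableSet, Real.volume_Icc_pi]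
  simp

theorem volume_hcube (c : Eu) (r : ℝ) : volume (hcube c r) = ENNReal.ofReal r ^ d := by
  rw [hcube_eq_preimage, (PiLp.volume_preserving_ofLp (Fin d)).measure_preimage
    (MeasurableSet.univ_pi fun i => measurableSet_Ico).nullMeasurableSet, Real.volume_pi_Ico]
  simp

theorem volume_hcube_ne_top (c : Eu) (r : ℝ) : volume (hcube c r) ≠ ∞ := by
  rw [volume_hcube]; finiteness

theorem volume_cube_ne_top (c : Eu) (r : ℝ) : volume (cube c r) ≠ ∞ := by
  rw [volume_cube]; finiteness

theorem volume_hcube_ne_zero (c : Eu) {r : ℝ} (hr : 0 < r) : volume (hcube c r) ≠ 0 := by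
  rw [volume_hcube]
  exact pow_ne_zero _ (by simpa using hr)

theorem volume_cube_ne_zero (c : Eu) {r : ℝ} (hr : 0 < r) : volume (cube c r) ≠ 0 := by
  rw [volume_cube]
  exact pow_ne_zero _ (by simpa using hr)

theorem hcube_subset_cube (c : Eu) (r : ℝ) : hcube c r ⊆ cube c r := by
  intro y hy i
  have := hy i
  rw [abs_le]
  constructor <;> linarith [this.1, this.2]

theorem hcube_ae_eq_cube (c : Eu) (r : ℝ) : hcube c r =ᵐ[volume] cube c r :=
  ae_eq_of_subset_of_measure_ge (hcube_subset_cube c r)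
    (by rw [volume_cube, volume_hcube]) (measurableSet_hcube c r).nullMeasurableSet
    (volume_cube_ne_top c r)

/-- Decompositions need half-open cubes, which tile; the theorem speaks of closed ones. This
identity moves integrals and essential infima between the two. -/
theorem restrict_hcube (c : Eu) (r : ℝ) :
    (volume : Measure Eu).restrict (hcube c r) = volume.restrict (cube c r) :=
  Measure.restrict_congr_set (hcube_ae_eq_cube c r)

theorem norm_sub_le_of_mem_cube {c y : Eu} {r : ℝ} (hr : 0 ≤ r) (hy : y ∈ cube c r) :
    ‖y - c‖ ≤ d * (r / 2) :=
  norm_le_of_abs_apply_le (by positivity) fun i => by simpa using hy i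

theorem cube_subset_ball (hd : 0 < d) (c : Eu) {r : ℝ} (hr : 0 < r) :
    cube c r ⊆ ball c (d * r) := by
  intro y hy
  rw [mem_ball, dist_eq_norm]
  refine (norm_sub_le_of_mem_cube hr.le hy).trans_lt ?_
  have : (0 : ℝ) < d := by exact_mod_cast hd
  nlinarith

theorem closedBall_subset_cube (c : Eu) (r : ℝ) : closedBall c r ⊆ cube c (2 * r) := by
  intro y hy i
  rw [mem_closedBall, dist_eq_norm] at hy
  have := abs_apply_le_norm (y - c) i
  simp only [PiLp.sub_apply] at this
  linarith

theorem volume_ball_le (c : Eu) (r : ℝ) : volume (ball c r) ≤ ENNReal.ofReal (2 * r) ^ d := by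
  rw [← volume_cube c]
  exact measure_mono (ball_subset_closedBall.trans (closedBall_subset_cube c r))

theorem volume_ball_le_cube (c : Eu) (r : ℝ) :
    volume (ball c (d * r)) ≤ ENNReal.ofReal ((2 * d) ^ d) * volume (cube c r) := by
  refine (volume_ball_le c _).trans ?_
  rw [volume_cube, ENNReal.ofReal_pow (by positivity), ← mul_pow,
    ← ENNReal.ofReal_mul (by positivity), mul_assoc]

/-- The cube with index `n` in the dyadic grid of level `k` adapted to `hcube c r`. -/
def dyadicCube (c : Eu) (r : ℝ) (k : ℕ) (n : Fin d → ℤ) : Set Eu :=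
  {y | ∀ i, ⌊2 ^ k * ((y i - c i) / r + 1 / 2)⌋ = n i}

/-- The centre of `dyadicCube c r k n`. -/
noncomputable def dyadicCenter (c : Eu) (r : ℝ) (k : ℕ) (n : Fin d → ℤ) : Eu :=
  WithLp.toLp 2 fun i => c i - r / 2 + (n i + 1 / 2) * (r / 2 ^ k)

theorem dyadicCube_eq_hcube (c : Eu) {r : ℝ} (hr : 0 < r) (k : ℕ) (n : Fin d → ℤ) :
    dyadicCube c r k n = hcube (dyadicCenter c r k n) (r / 2 ^ k) := by
  ext y
  refine forall_congr' fun i => ?_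
  rw [Int.floor_eq_iff]
  have h2 : (0 : ℝ) < 2 ^ k := by positivity
  set s : ℝ := r / 2 ^ k with hs
  have hspos : 0 < s := by positivity
  have key : (2 : ℝ) ^ k * ((y i - c i) / r + 1 / 2) = (y i - c i + r / 2) / s := by
    rw [hs]; field_simp
  rw [key, le_div_iff₀ hspos, div_lt_iff₀ hspos]
  simp only [dyadicCenter]
  constructor <;> rintro ⟨h3, h4⟩ <;> constructor <;> linarith

theorem mem_dyadicCube_self (c : Eu) (r : ℝ) (k : ℕ) (y : Eu) :
    y ∈ dyadicCube c r k fun i => ⌊2 ^ k * ((y i - c i) / r + 1 / 2)⌋ := fun _ => rfl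

theorem dyadicCube_zero (c : Eu) {r : ℝ} (hr : 0 < r) : dyadicCube c r 0 0 = hcube c r := by
  rw [dyadicCube_eq_hcube c hr]
  congr 1
  · ext i
    simp [dyadicCenter]
    ring
  · simp

theorem dyadicCube_disjoint {c : Eu} {r : ℝ} {k : ℕ} {m n : Fin d → ℤ} (h : m ≠ n) :
    Disjoint (dyadicCube c r k m) (dyadicCube c r k n) := by
  rw [Set.disjoint_left]
  intro y hm hn
  exact h (funext fun i => (hm i).symm.trans (hn i))

/-- The fine dyadic index determines the coarse one by integer division; this is why the grids are
nested. -/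
theorem floor_two_pow_mul_eq {k l : ℕ} (hkl : k ≤ l) (t : ℝ) :
    ⌊2 ^ k * t⌋ = ⌊2 ^ l * t⌋ / 2 ^ (l - k) := by
  have h : (2 : ℝ) ^ k * t = 2 ^ l * t / ((2 ^ (l - k) : ℕ) : ℝ) := by
    push_cast
    rw [eq_div_iff (by positivity), mul_right_comm, ← pow_add, Nat.add_sub_cancel' hkl]
  rw [h, Int.floor_div_natCast]
  norm_cast

theorem dyadicCube_subset {c : Eu} {r : ℝ} {k l : ℕ} (hkl : k ≤ l) {m n : Fin d → ℤ} {y : Eu}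
    (hm : y ∈ dyadicCube c r k m) (hn : y ∈ dyadicCube c r l n) :
    dyadicCube c r l n ⊆ dyadicCube c r k m := by
  intro z hz i
  rw [floor_two_pow_mul_eq hkl, hz i, ← hn i, ← floor_two_pow_mul_eq hkl, hm i]

theorem measurableSet_dyadicCube (c : Eu) {r : ℝ} (hr : 0 < r) (k : ℕ) (n : Fin d → ℤ) :
    MeasurableSet (dyadicCube c r k n) := by
  rw [dyadicCube_eq_hcube c hr]
  exact measurableSet_hcube _ _

theorem volume_dyadicCube (c : Eu) {r : ℝ} (hr : 0 < r) (k : ℕ) (n : Fin d → ℤ) :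
    volume (dyadicCube c r k n) = ENNReal.ofReal (r / 2 ^ k) ^ d := by
  rw [dyadicCube_eq_hcube c hr, volume_hcube]

theorem volume_dyadicCube_succ (c : Eu) {r : ℝ} (hr : 0 < r) (k : ℕ) (m n : Fin d → ℤ) :
    volume (dyadicCube c r k m) = 2 ^ d * volume (dyadicCube c r (k + 1) n) := by
  rw [volume_dyadicCube c hr, volume_dyadicCube c hr, ← mul_pow]
  congr 1
  rw [← ENNReal.ofReal_ofNat 2, ← ENNReal.ofReal_mul (by norm_num)]
  congr 1
  rw [pow_succ]
  field_simp

/-- Lebesgue measure is differentiated by cubes: averages over the dyadic cubes shrinking to a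
point converge almost everywhere. -/
theorem ae_tendsto_dyadicCube (hd : 0 < d) (c : Eu) {r : ℝ} (hr : 0 < r) {g : Eu → ℝ≥0∞}
    (hg : AEMeasurable g volume) (hg' : ∫⁻ y, g y ≠ ∞) :
    ∀ᵐ y, Tendsto (fun k : ℕ =>
      (∫⁻ z in dyadicCube c r k (fun i => ⌊2 ^ k * ((y i - c i) / r + 1 / 2)⌋), g z) /
        volume (dyadicCube c r k fun i => ⌊2 ^ k * ((y i - c i) / r + 1 / 2)⌋))
      atTop (𝓝 (g y)) := by
  have hd1 : (1 : ℝ) ≤ d := by exact_mod_cast hd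
  -- The factor 3 is the enlargement in the Vitali covering argument. A ball of radius 3dℓ lies in a
  -- cube of side 6dℓ, which gives the constant (6d)^d.
  have hcomp : ∀ (x y : Eu) (ℓ : ℝ), 0 < ℓ → volume (closedBall x (3 * (d * ℓ))) ≤
      (((6 * d) ^ d : NNReal) : ℝ≥0∞) * volume (cube y ℓ) := by
    intro x y ℓ hℓ
    refine (measure_mono (closedBall_subset_cube x _)).trans ?_
    rw [volume_cube, volume_cube]
    push_cast
    rw [← mul_pow]
    gcongr
    rw [show (2 : ℝ) * (3 * (d * ℓ)) = (6 * d) * ℓ by ring, ENNReal.ofReal_mul (by positivity),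
      ENNReal.ofReal_mul (by positivity)]
    simp
  let v := Vitali.vitaliFamily (volume : Measure Eu) ((6 * d) ^ d) (by
    intro x
    refine (Filter.Eventually.frequently ?_)
    filter_upwards [self_mem_nhdsWithin] with s hs
    have hs : 0 < s := hs
    have h1 := hcomp x x (s / d) (by positivity)
    rw [mul_div_cancel₀ _ (by positivity : (d : ℝ) ≠ 0)] at h1
    refine h1.trans ?_
    gcongr
    refine (cube_subset_ball hd x (by positivity)).trans ?_
    rw [mul_div_cancel₀ _ (by positivity : (d : ℝ) ≠ 0)]
    exact ball_subset_closedBall)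
  filter_upwards [v.ae_tendsto_lintegral_div hg hg'] with y hy
  set n : ℕ → Fin d → ℤ := fun k i => ⌊2 ^ k * ((y i - c i) / r + 1 / 2)⌋
  have hy_mem : ∀ k, y ∈ cube (dyadicCenter c r k (n k)) (r / 2 ^ k) := by
    intro k
    apply hcube_subset_cube
    rw [← dyadicCube_eq_hcube c hr]
    exact mem_dyadicCube_self c r k y
  have hsub : ∀ k, cube (dyadicCenter c r k (n k)) (r / 2 ^ k) ⊆
      closedBall y (d * (r / 2 ^ k)) := by
    intro k z hz
    have h1 := norm_sub_le_of_mem_cube (by positivity) hz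
    have h2 := norm_sub_le_of_mem_cube (by positivity) (hy_mem k)
    rw [mem_closedBall, dist_eq_norm]
    calc ‖z - y‖ ≤ ‖z - dyadicCenter c r k (n k)‖ + ‖y - dyadicCenter c r k (n k)‖ := by
          rw [← dist_eq_norm, ← dist_eq_norm, ← dist_eq_norm]
          exact dist_triangle_right _ _ _
      _ ≤ _ := by linarith
  have hlim : Tendsto (fun k : ℕ => (d : ℝ) * (r / 2 ^ k)) atTop (𝓝 0) := by
    have h := (tendsto_pow_atTop_nhds_zero_of_lt_one (r := (1 / 2 : ℝ)) (by norm_num)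
      (by norm_num)).const_mul (d * r)
    simp only [mul_zero] at h
    refine h.congr fun k => ?_
    rw [one_div, inv_pow]
    ring
  -- The Vitali family consists of closed sets with nonempty interior, so the limit is taken along
  -- the closed cubes; the half-open ones have the same averages.
  have ht : Tendsto (fun k : ℕ => cube (dyadicCenter c r k (n k)) (r / 2 ^ k)) atTop
      (v.filterAt y) := by
    rw [VitaliFamily.tendsto_filterAt_iff]
    refine ⟨Eventually.of_forall fun k => ⟨isClosed_cube _ _, ?_, d * (r / 2 ^ k), hsub k,
      hcomp _ _ _ (by positivity)⟩, ?_⟩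
    · refine ⟨dyadicCenter c r k (n k), mem_interior.2
        ⟨ball (dyadicCenter c r k (n k)) (r / 2 ^ k / 2), ?_, isOpen_ball,
          mem_ball_self (by positivity)⟩⟩
      refine ball_subset_closedBall.trans ((closedBall_subset_cube _ _).trans_eq ?_)
      congr 1
      ring
    · intro ε hε
      filter_upwards [hlim.eventually (gt_mem_nhds hε)] with k hk
      exact (hsub k).trans (closedBall_subset_closedBall hk.le)
  refine (hy.comp ht).congr fun k => ?_
  simp only [Function.comp]
  rw [dyadicCube_eq_hcube c hr, restrict_hcube, volume_hcube, volume_cube]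

/-- Calderón–Zygmund decomposition of a half-open cube at height `t`. -/
theorem exists_calderonZygmund (hd : 0 < d) (c : Eu) {r : ℝ} (hr : 0 < r) {g : Eu → ℝ≥0∞}
    (hg : AEMeasurable g (volume.restrict (hcube c r))) {t : ℝ≥0∞} (ht : t ≠ ∞)
    (havg : ∫⁻ y in hcube c r, g y ≤ t * volume (hcube c r)) :
    ∃ S : Set (Eu × ℝ), S.Countable ∧
      (∀ s ∈ S, 0 < s.2 ∧ hcube s.1 s.2 ⊆ hcube c r ∧
        t * volume (hcube s.1 s.2) < ∫⁻ y in hcube s.1 s.2, g y ∧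
        ∫⁻ y in hcube s.1 s.2, g y ≤ 2 ^ d * t * volume (hcube s.1 s.2)) ∧
      S.PairwiseDisjoint (fun s => hcube s.1 s.2) ∧
      ∀ᵐ y, y ∈ hcube c r → y ∉ ⋃ s ∈ S, hcube s.1 s.2 → g y ≤ t := by
  classical
  let D : ℕ × (Fin d → ℤ) → Set Eu := fun i => dyadicCube c r i.1 i.2
  let bad : ℕ × (Fin d → ℤ) → Prop := fun i =>
    D i ⊆ hcube c r ∧ t * volume (D i) < ∫⁻ y in D i, g y
  -- The stopping cubes: bad cubes with no bad dyadic ancestor.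
  let T : Set (ℕ × (Fin d → ℤ)) :=
    {i | bad i ∧ ∀ j : ℕ × (Fin d → ℤ), j.1 < i.1 → D i ⊆ D j → ¬ bad j}
  let e : ℕ × (Fin d → ℤ) → Eu × ℝ := fun i => (dyadicCenter c r i.1 i.2, r / 2 ^ i.1)
  have hDe : ∀ i, hcube (e i).1 (e i).2 = D i := fun i => (dyadicCube_eq_hcube c hr _ _).symm
  have hne : ∀ i, (D i).Nonempty := by
    intro i
    rw [nonempty_iff_ne_empty]
    intro h
    have := volume_hcube_ne_zero (e i).1 (r := (e i).2) (by positivity)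
    rw [hDe, h] at this
    simp at this
  have hTdisj : T.PairwiseDisjoint D := by
    have main : ∀ i ∈ T, ∀ j ∈ T, i ≠ j → i.1 ≤ j.1 → Disjoint (D i) (D j) := by
      rintro ⟨k, n⟩ hi ⟨l, m⟩ hj hij (hkl : k ≤ l)
      rcases hkl.eq_or_lt with rfl | hlt
      · exact dyadicCube_disjoint fun h => hij (Prod.ext rfl h)
      · rw [Set.disjoint_left]
        intro y hy hy'
        exact hj.2 (k, n) hlt (dyadicCube_subset hkl hy hy') hi.1
    intro i hi j hj hij
    rcases le_total i.1 j.1 with h | h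
    · exact main i hi j hj hij h
    · exact (main j hj i hi hij.symm h).symm
  refine ⟨e '' T, (Set.to_countable T).image e, ?_, ?_, ?_⟩
  · rintro _ ⟨⟨k, n⟩, hi, rfl⟩
    rw [hDe]
    refine ⟨by positivity, hi.1.1, hi.1.2, ?_⟩
    obtain ⟨y, hy⟩ := hne (k, n)
    have hy0 : y ∈ dyadicCube c r 0 0 := by
      rw [dyadicCube_zero c hr]; exact hi.1.1 hy
    rcases k with _ | k
    · have hn : n = 0 := by
        by_contra hn
        exact (Set.disjoint_left.1 (dyadicCube_disjoint hn) hy) hy0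
      exfalso
      have := hi.1.2
      simp only [D, hn, dyadicCube_zero c hr] at this
      exact absurd havg (not_le.2 this)
    · set m : Fin d → ℤ := fun i => ⌊2 ^ k * ((y i - c i) / r + 1 / 2)⌋
      have hym : y ∈ dyadicCube c r k m := mem_dyadicCube_self c r k y
      have hsub : D (k + 1, n) ⊆ D (k, m) := dyadicCube_subset (Nat.le_succ k) hym hy
      -- The parent is not bad, and it is 2^d times larger; hence the upper bound 2^d t for the
      -- mean. Level 0 is excluded by `havg`, so a parent inside the cube exists.
      have hnb := hi.2 (k, m) (Nat.lt_succ_self k) hsub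
      have hsub0 : D (k, m) ⊆ hcube c r := by
        rw [← dyadicCube_zero c hr]
        exact dyadicCube_subset (Nat.zero_le k) hy0 hym
      have h3 : ∫⁻ y in D (k, m), g y ≤ t * volume (D (k, m)) := by
        by_contra h
        exact hnb ⟨hsub0, not_le.1 h⟩
      calc ∫⁻ y in D (k + 1, n), g y ≤ ∫⁻ y in D (k, m), g y := lintegral_mono_set hsub
        _ ≤ t * volume (D (k, m)) := h3
        _ = _ := by
          simp only [D]
          rw [volume_dyadicCube_succ c hr k m n]
          ring
  · rintro _ ⟨i, hi, rfl⟩ _ ⟨j, hj, rfl⟩ hij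
    simp only [Function.onFun, hDe]
    exact hTdisj hi hj fun h => hij (by rw [h])
  · have hfin : ∫⁻ y, (hcube c r).indicator g y ≠ ∞ := by
      rw [lintegral_indicator (measurableSet_hcube c r)]
      exact ne_top_of_le_ne_top (ENNReal.mul_ne_top ht (volume_hcube_ne_top c r)) havg
    filter_upwards [ae_tendsto_dyadicCube hd c hr
      ((aemeasurable_indicator_iff (measurableSet_hcube c r)).2 hg) hfin] with y hy hyQ hyS
    rw [indicator_of_mem hyQ] at hy
    refine le_of_tendsto' hy fun k => ?_
    set n : ℕ → Fin d → ℤ := fun k i => ⌊2 ^ k * ((y i - c i) / r + 1 / 2)⌋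
    change (∫⁻ z in D (k, n k), _) / volume (D (k, n k)) ≤ t
    have hyn : ∀ k, y ∈ D (k, n k) := fun k => mem_dyadicCube_self c r k y
    have hsub0 : ∀ k, D (k, n k) ⊆ hcube c r := by
      intro k
      rw [← dyadicCube_zero c hr] at hyQ ⊢
      exact dyadicCube_subset (Nat.zero_le k) hyQ (hyn k)
    have hnot : ∀ k, ¬ bad (k, n k) := by
      intro k hk
      -- If some cube around y were bad, the coarsest such cube would be a stopping cube, contrary
      -- to y lying outside the union.
      have hex : ∃ k, bad (k, n k) := ⟨k, hk⟩
      apply hyS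
      simp only [mem_iUnion]
      refine ⟨e (Nat.find hex, n (Nat.find hex)), ⟨_, ⟨Nat.find_spec hex, ?_⟩, rfl⟩, ?_⟩
      · rintro ⟨l, m⟩ hl hsub hbad
        have hm : m = n l := by
          by_contra hm
          exact Set.disjoint_left.1 (dyadicCube_disjoint hm) (hsub (hyn _)) (hyn l)
        rw [hm] at hbad
        exact Nat.find_min hex hl hbad
      · rw [hDe]; exact hyn _
    have h3 : ∫⁻ y in D (k, n k), g y ≤ t * volume (D (k, n k)) := by
      by_contra h
      exact hnot k ⟨hsub0 k, not_le.1 h⟩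
    refine ENNReal.div_le_of_le_mul (le_trans (le_of_eq ?_) h3)
    refine setLIntegral_congr_fun (measurableSet_dyadicCube c hr _ _) fun z hz => ?_
    exact indicator_of_mem (hsub0 k hz) _

end Cubes

/-! ### Slow variation of radius functions defined by doubling quantities. -/

section CriticalRadius

open Set Filter Topology Metric

variable {d : ℕ}

local notation "Eu" => EuclideanSpace ℝ (Fin d)

/-- Iterate doubling along the powers of 2 that bracket t/r; monotonicity covers the remainder at
the cost of one more factor D. -/
theorem le_rpow_logb_mul_of_doubling {φ : ℝ → ℝ} (hmono : Monotone φ) {D : ℝ} (hD : 1 ≤ D)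
    (hφ : ∀ r, 0 < r → φ (2 * r) ≤ D * φ r) {r t : ℝ} (hr : 0 < r) (hrt : r ≤ t)
    (h0 : 0 ≤ φ r) : φ t ≤ D * (t / r) ^ Real.logb 2 D * φ r := by
  obtain ⟨n, hn1, hn2⟩ := exists_nat_pow_near ((one_le_div hr).2 hrt) (one_lt_two (α := ℝ))
  have hiter : ∀ k : ℕ, φ (2 ^ k * r) ≤ D ^ k * φ r := by
    intro k
    induction k with
    | zero => simp
    | succ k ih =>
      calc φ (2 ^ (k + 1) * r) = φ (2 * (2 ^ k * r)) := by rw [pow_succ]; ring_nf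
        _ ≤ D * φ (2 ^ k * r) := hφ _ (by positivity)
        _ ≤ D * (D ^ k * φ r) := by gcongr
        _ = _ := by ring
  have hDn : D ^ n ≤ (t / r) ^ Real.logb 2 D := by
    have h2 : D = 2 ^ Real.logb 2 D := by rw [Real.rpow_logb] <;> linarith
    calc D ^ n = (2 ^ n) ^ Real.logb 2 D := by
          conv_lhs => rw [h2]
          rw [← Real.rpow_natCast, ← Real.rpow_natCast, ← Real.rpow_mul (by norm_num),
            ← Real.rpow_mul (by norm_num), mul_comm]
      _ ≤ _ := Real.rpow_le_rpow (by positivity) hn1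
          (Real.logb_nonneg (by norm_num) hD)
  calc φ t ≤ φ (2 ^ (n + 1) * r) := hmono ((div_lt_iff₀ hr).1 hn2).le
    _ ≤ D ^ (n + 1) * φ r := hiter _
    _ = D * D ^ n * φ r := by ring
    _ ≤ _ := by gcongr

theorem rpow_logb_mul_le_of_reverse_doubling {φ : ℝ → ℝ} (hmono : Monotone φ) {A : ℝ}
    (hA : 1 < A) (hφ : ∀ r, 0 < r → A * φ r ≤ φ (4 * r)) {r t : ℝ} (hr : 0 < r) (hrt : r ≤ t)
    (h0 : 0 ≤ φ r) : (t / r) ^ Real.logb 4 A * φ r ≤ A * φ t := by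
  obtain ⟨n, hn1, hn2⟩ := exists_nat_pow_near ((one_le_div hr).2 hrt)
    (by norm_num : (1 : ℝ) < 4)
  have hiter : ∀ k : ℕ, A ^ k * φ r ≤ φ (4 ^ k * r) := by
    intro k
    induction k with
    | zero => simp
    | succ k ih =>
      calc A ^ (k + 1) * φ r = A * (A ^ k * φ r) := by ring
        _ ≤ A * φ (4 ^ k * r) := by gcongr
        _ ≤ φ (4 * (4 ^ k * r)) := hφ _ (by positivity)
        _ = _ := by rw [pow_succ]; ring_nf
  have hAn : (t / r) ^ Real.logb 4 A ≤ A ^ (n + 1) := by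
    have h2 : A = 4 ^ Real.logb 4 A := by rw [Real.rpow_logb] <;> linarith
    calc (t / r) ^ Real.logb 4 A ≤ (4 ^ (n + 1)) ^ Real.logb 4 A :=
          Real.rpow_le_rpow (div_nonneg (hr.le.trans hrt) hr.le) hn2.le
            (Real.logb_nonneg (by norm_num) hA.le)
      _ = A ^ (n + 1) := by
          conv_rhs => rw [h2]
          rw [← Real.rpow_natCast, ← Real.rpow_natCast, ← Real.rpow_mul (by norm_num),
            ← Real.rpow_mul (by norm_num), mul_comm]
  calc (t / r) ^ Real.logb 4 A * φ r ≤ A ^ (n + 1) * φ r := by gcongr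
    _ = A * (A ^ n * φ r) := by ring
    _ ≤ A * φ (4 ^ n * r) := by gcongr; exact hiter n
    _ ≤ A * φ t := by gcongr; exact hmono ((le_div_iff₀ hr).1 hn1)

/-- The upper half of the slow-variation inequality follows from the lower half. -/
theorem slowVariation_of_lower {ρ : Eu → ℝ} (hρ : ∀ x, 0 < ρ x) {ε N : ℝ} (hε : 0 < ε)
    (hε1 : ε ≤ 1) (hN : 0 < N)
    (h : ∀ x y : Eu, ε * (1 + ‖x - y‖ / ρ x) ^ (-N) ≤ ρ y / ρ x) :
    SlowVariation ρ (2 ^ N / ε) N := by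
  have h2N : (1 : ℝ) ≤ 2 ^ N := Real.one_le_rpow (by norm_num) hN.le
  have hC : 1 ≤ 2 ^ N / ε := (one_le_div hε).2 (hε1.trans h2N)
  refine ⟨hC, hN, fun x y => ⟨?_, ?_⟩⟩
  · refine le_trans ?_ (h x y)
    have : 0 ≤ (1 + ‖x - y‖ / ρ x) ^ (-N) := by have := hρ x; positivity
    gcongr
    rw [one_div, inv_div]
    exact div_le_self hε.le h2N
  · have hx := hρ x
    have hy := hρ y
    set u := ρ y / ρ x with hu
    set τ := ‖x - y‖ / ρ x with hτ
    have hupos : 0 < u := by positivity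
    have hτ0 : 0 ≤ τ := by positivity
    have hN1 : 0 < N / (N + 1) := by positivity
    have h1τ : 1 ≤ (1 + τ) ^ (N / (N + 1)) := Real.one_le_rpow (by linarith) hN1.le
    -- This is the lower bound with x and y exchanged, rewritten through u and τ. Since u stands on
    -- both sides, it bounds u: by a constant if τ ≤ u, and by (1 + τ)^{N/(N+1)} up to a constant
    -- otherwise.
    have key : u * u ^ N ≤ ε⁻¹ * (u + τ) ^ N := by
      have h1 := h y x
      have e1 : ‖y - x‖ / ρ y = τ / u := by rw [hτ, hu, norm_sub_rev]; field_simp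
      have e2 : ρ x / ρ y = u⁻¹ := by rw [hu, inv_div]
      rw [e1, e2, Real.rpow_neg (by positivity)] at h1
      have e3 : 1 + τ / u = (u + τ) / u := by field_simp
      rw [e3, Real.div_rpow (by positivity) hupos.le, inv_div] at h1
      have hp : 0 < (u + τ) ^ N := by positivity
      rw [inv_eq_one_div u, ← mul_div_assoc, div_le_div_iff₀ hp hupos] at h1
      rw [inv_mul_eq_div, le_div_iff₀ hε]
      linarith
    rcases le_total τ u with hc | hc
    · have h3 : u * u ^ N ≤ (2 ^ N / ε) * u ^ N := by
        refine key.trans ?_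
        have : (u + τ) ^ N ≤ 2 ^ N * u ^ N := by
          rw [← Real.mul_rpow (by norm_num) hupos.le]
          exact Real.rpow_le_rpow (by positivity) (by linarith) hN.le
        calc ε⁻¹ * (u + τ) ^ N ≤ ε⁻¹ * (2 ^ N * u ^ N) := by gcongr
          _ = _ := by ring
      have h4 := le_of_mul_le_mul_right h3 (by positivity)
      nlinarith
    · have h3 : u ^ (N + 1) ≤ (2 ^ N / ε) * (1 + τ) ^ N := by
        rw [Real.rpow_add hupos, Real.rpow_one, mul_comm]
        refine key.trans ?_
        have : (u + τ) ^ N ≤ 2 ^ N * (1 + τ) ^ N := by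
          rw [← Real.mul_rpow (by norm_num) (by positivity)]
          exact Real.rpow_le_rpow (by positivity) (by linarith) hN.le
        calc ε⁻¹ * (u + τ) ^ N ≤ ε⁻¹ * (2 ^ N * (1 + τ) ^ N) := by gcongr
          _ = _ := by ring
      calc u = (u ^ (N + 1)) ^ (1 / (N + 1)) := by
            rw [← Real.rpow_mul hupos.le, mul_one_div_cancel (by positivity), Real.rpow_one]
        _ ≤ ((2 ^ N / ε) * (1 + τ) ^ N) ^ (1 / (N + 1)) := by
            gcongr
        _ = (2 ^ N / ε) ^ (1 / (N + 1)) * (1 + τ) ^ (N / (N + 1)) := by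
            rw [Real.mul_rpow (by positivity) (by positivity), ← Real.rpow_mul (by positivity),
              mul_one_div]
        _ ≤ (2 ^ N / ε) ^ (1 : ℝ) * (1 + τ) ^ (N / (N + 1)) := by
            gcongr
            rw [div_le_one (by positivity)]; linarith
        _ = _ := by rw [Real.rpow_one]

/-- A radius function cut out by a quantity `h` comparable with a power of a doubling and reverse
doubling set function on balls is positive and varies slowly. -/
theorem slowVariation_of_doubling {m h : Eu → ℝ → ℝ}
    (hmono : ∀ x y r s, ball x r ⊆ ball y s → m x r ≤ m y s)
    (hpos : ∀ x r, 0 < r → 0 < m x r) {D A a c₁ c₂ : ℝ} (hD : 2 ≤ D)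
    (hDm : ∀ x r, 0 < r → m x (2 * r) ≤ D * m x r) (hA : 1 < A)
    (hAm : ∀ x r, 0 < r → A * m x r ≤ m x (4 * r)) (ha : 0 < a) (hc₁ : 0 < c₁) (hc₂ : 0 < c₂)
    (h₁ : ∀ x r, 0 < r → h x r ≤ c₁ * m x r ^ a) (h₂ : ∀ x r, 0 < r → m x r ^ a ≤ c₂ * h x r) :
    (∀ x, 0 < sSup {r | 0 < r ∧ h x r ≤ 1}) ∧
      ∃ C₀ N₀, SlowVariation (fun x => sSup {r | 0 < r ∧ h x r ≤ 1}) C₀ N₀ := by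
  have hm1 : ∀ x, Monotone (m x) := fun x r s hrs => hmono _ _ _ _ (ball_subset_ball hrs)
  set κ := Real.logb 4 A with hκ
  set M := Real.logb 2 D with hM
  have hκpos : 0 < κ := Real.logb_pos (by norm_num) hA
  have hMpos : 0 < M := Real.logb_pos (by norm_num) (by linarith)
  set c₄ := c₂ ^ (1 / a) with hc₄
  have hc₄pos : 0 < c₄ := by positivity
  have hup : ∀ x r, 0 < r → h x r ≤ 1 → m x r ≤ c₄ := by
    intro x r hr hh
    have h3 : m x r ^ a ≤ c₂ := (h₂ x r hr).trans (by nlinarith)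
    calc m x r = (m x r ^ a) ^ (1 / a) := by
          rw [← Real.rpow_mul (hpos x r hr).le, mul_one_div_cancel ha.ne', Real.rpow_one]
      _ ≤ c₄ := by
        have := hpos x r hr
        rw [hc₄]; gcongr
  set c₅ := (1 / c₁) ^ (1 / a) with hc₅
  have hc₅pos : 0 < c₅ := by positivity
  have hlow : ∀ x r, 0 < r → m x r ≤ c₅ → h x r ≤ 1 := by
    intro x r hr hh
    refine (h₁ x r hr).trans ?_
    have h3 : m x r ^ a ≤ 1 / c₁ := by
      calc m x r ^ a ≤ c₅ ^ a := Real.rpow_le_rpow (hpos x r hr).le hh ha.le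
        _ = 1 / c₁ := by
          rw [hc₅, ← Real.rpow_mul (by positivity), one_div_mul_cancel ha.ne', Real.rpow_one]
    calc c₁ * m x r ^ a ≤ c₁ * (1 / c₁) := by gcongr
      _ = 1 := by field_simp
  have hrev : ∀ x r t, 0 < r → r ≤ t → m x r ≤ A * (r / t) ^ κ * m x t := by
    intro x r t hr hrt
    have ht : 0 < t := hr.trans_le hrt
    have h3 := rpow_logb_mul_le_of_reverse_doubling (hm1 x) hA (hAm x) hr hrt (hpos x r hr).le
    rw [← hκ] at h3
    have h4 : (t / r) ^ κ * (r / t) ^ κ = 1 := by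
      rw [← Real.mul_rpow (by positivity) (by positivity)]
      have : t / r * (r / t) = 1 := by field_simp
      rw [this, Real.one_rpow]
    calc m x r = ((t / r) ^ κ * m x r) * (r / t) ^ κ := by
          rw [mul_right_comm, h4, one_mul]
      _ ≤ (A * m x t) * (r / t) ^ κ := by gcongr
      _ = _ := by ring
  -- Needed because `sSup` of an unbounded set of reals is 0. Reverse doubling makes m grow like a
  -- power of r, while h ≤ 1 keeps it bounded.
  have hbdd : ∀ x, BddAbove {r | 0 < r ∧ h x r ≤ 1} := by
    intro x
    refine ⟨max 1 ((A * c₄ / m x 1) ^ (1 / κ)), ?_⟩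
    rintro r ⟨hr, hh⟩
    rcases le_total r 1 with h1 | h1
    · exact le_max_of_le_left h1
    · refine le_max_of_le_right ?_
      have h3 := rpow_logb_mul_le_of_reverse_doubling (hm1 x) hA (hAm x) one_pos h1
        (hpos x 1 one_pos).le
      rw [← hκ, div_one] at h3
      have h4 : r ^ κ ≤ A * c₄ / m x 1 := by
        rw [le_div_iff₀ (hpos x 1 one_pos)]
        exact h3.trans (by gcongr; exact hup x r hr hh)
      calc r = (r ^ κ) ^ (1 / κ) := by
            rw [← Real.rpow_mul hr.le, mul_one_div_cancel hκpos.ne', Real.rpow_one]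
        _ ≤ _ := by gcongr
  -- The source of lower bounds for the radius: a bound of m at one scale R decays by reverse
  -- doubling, so all sufficiently small s are admissible.
  have hcrit : ∀ y R T, 0 < R → m y R ≤ T → 0 < T →
      ∀ s, 0 < s → s ≤ R → s ≤ R * (c₅ / (A * T)) ^ (1 / κ) →
        s ≤ sSup {r | 0 < r ∧ h y r ≤ 1} := by
    intro y R T hR hm hT s hs hsR hsT
    refine le_csSup (hbdd y) ⟨hs, hlow y s hs ?_⟩
    have h3 : (s / R) ^ κ ≤ c₅ / (A * T) := by
      calc (s / R) ^ κ ≤ ((c₅ / (A * T)) ^ (1 / κ)) ^ κ := by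
            gcongr
            rw [div_le_iff₀ hR]; linarith
        _ = _ := by
            rw [← Real.rpow_mul (by positivity), one_div_mul_cancel hκpos.ne', Real.rpow_one]
    calc m y s ≤ A * (s / R) ^ κ * m y R := hrev y s R hs hsR
      _ ≤ A * (c₅ / (A * T)) * T := by
        have := hpos y R hR
        gcongr
      _ = c₅ := by field_simp
  have hρ : ∀ x, 0 < sSup {r | 0 < r ∧ h x r ≤ 1} := by
    intro x
    have hm := hpos x 1 one_pos
    have hs : 0 < min 1 ((c₅ / (A * m x 1)) ^ (1 / κ)) := by positivity
    refine hs.trans_le (hcrit x 1 (m x 1) one_pos le_rfl hm _ hs (min_le_left _ _) ?_)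
    rw [one_mul]
    exact min_le_right _ _
  refine ⟨hρ, ?_⟩
  set ρ : Eu → ℝ := fun x => sSup {r | 0 < r ∧ h x r ≤ 1} with hρdef
  have hup' : ∀ x r, 0 < r → r < ρ x → m x r ≤ c₄ := by
    intro x r hr hrρ
    obtain ⟨s, ⟨hs, hs'⟩, hrs⟩ := exists_lt_of_lt_csSup (by
      by_contra hne
      rw [not_nonempty_iff_eq_empty] at hne
      simp only [hρdef, hne, Real.sSup_empty] at hrρ
      linarith) hrρ
    exact (hm1 x hrs.le).trans (hup x s hs hs')
  set G := D * 4 ^ M * c₄ with hG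
  have hGpos : 0 < G := by positivity
  set ε := min 1 ((c₅ / (A * G)) ^ (1 / κ)) with hε
  have hεpos : 0 < ε := by positivity
  have hN : 0 < M / κ := by positivity
  refine ⟨_, _, slowVariation_of_lower hρ hεpos (min_le_left _ _) hN ?_⟩
  intro x y
  have hx : 0 < ρ x := hρ x
  set l := 1 + ‖x - y‖ / ρ x with hl
  have hl1 : 1 ≤ l := by
    have : 0 ≤ ‖x - y‖ / ρ x := by positivity
    linarith
  have hlpos : 0 < l := by linarith
  have hxy : ‖x - y‖ ≤ l * ρ x := by
    rw [hl, add_mul, div_mul_cancel₀ _ hx.ne']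
    linarith
  -- The ball around y lies in B(x, 2lρ(x)); doubling compares this with B(x, ρ(x)/2), where m ≤ c₄.
  -- Half the radius is used because `hup'` requires a radius strictly below the supremum.
  have hmy : m y (l * ρ x) ≤ G * l ^ M := by
    calc m y (l * ρ x) ≤ m x (2 * (l * ρ x)) := by
          refine hmono _ _ _ _ (ball_subset_ball' ?_)
          rw [dist_comm, dist_eq_norm]
          linarith
      _ ≤ D * (2 * (l * ρ x) / (ρ x / 2)) ^ M * m x (ρ x / 2) :=
          le_rpow_logb_mul_of_doubling (hm1 x) (by linarith) (hDm x) (by positivity)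
            (by nlinarith) (hpos x _ (by positivity)).le
      _ ≤ D * (4 * l) ^ M * c₄ := by
          have e : 2 * (l * ρ x) / (ρ x / 2) = 4 * l := by field_simp; norm_num
          rw [e]
          gcongr
          exact hup' x _ (by positivity) (by linarith)
      _ = G * l ^ M := by
          rw [Real.mul_rpow (by norm_num) hlpos.le, hG]; ring
  have hneg : l ^ (-(M / κ)) ≤ 1 := by
    rw [Real.rpow_neg hlpos.le]
    exact inv_le_one_of_one_le₀ (Real.one_le_rpow hl1 hN.le)
  -- Growth exponent M over decay exponent κ gives N = M/κ. The factor l ≥ 1 in l ρ(x) is then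
  -- discarded.
  have hs := hcrit y (l * ρ x) (G * l ^ M) (by positivity) hmy (by positivity)
    (ε * l ^ (-(M / κ)) * (l * ρ x)) (by positivity) ?_ ?_
  · rw [le_div_iff₀ hx]
    refine le_trans ?_ hs
    have : 0 ≤ ε * l ^ (-(M / κ)) := by positivity
    gcongr
    nlinarith
  · have : ε * l ^ (-(M / κ)) ≤ 1 * 1 := by
      gcongr
      exact min_le_left _ _
    have h5 : 0 < l * ρ x := by positivity
    nlinarith
  · have e : (c₅ / (A * (G * l ^ M))) ^ (1 / κ) =
        (c₅ / (A * G)) ^ (1 / κ) * l ^ (-(M / κ)) := by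
      rw [show c₅ / (A * (G * l ^ M)) = c₅ / (A * G) * (l ^ M)⁻¹ by field_simp,
        Real.mul_rpow (by positivity) (by positivity), ← Real.rpow_neg hlpos.le,
        ← Real.rpow_mul hlpos.le, mul_one_div, neg_div]
    rw [e, mul_comm]
    gcongr
    exact min_le_right _ _

end CriticalRadius

/-! ### The measure V^{d/2} dx and the critical radius of a potential. -/

section Potential

open Set Filter Topology Metric

variable {d : ℕ}

local notation "Eu" => EuclideanSpace ℝ (Fin d)

theorem lintegral_rpow_le_mul_measure_univ {α : Type*} [MeasurableSpace α] {μ : Measure α}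
    {f : α → ℝ≥0∞} (hf : AEMeasurable f μ) {p q : ℝ} (hp : 0 < p) (hpq : p ≤ q) :
    (∫⁻ x, f x ^ p ∂μ) ^ (1 / p) ≤
      (∫⁻ x, f x ^ q ∂μ) ^ (1 / q) * μ univ ^ (1 / p - 1 / q) := by
  have h := eLpNorm'_le_eLpNorm'_mul_rpow_measure_univ hp hpq hf.aestronglyMeasurable
  simpa [eLpNorm'] using h

theorem measureReal_ball (hd : 0 < d) (x : Eu) {r : ℝ} (hr : 0 ≤ r) :
    volume.real (ball x r) = r ^ d * volume.real (ball (0 : Eu) 1) := by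
  have : Nonempty (Fin d) := ⟨⟨0, hd⟩⟩
  rw [Measure.real, Measure.addHaar_ball _ _ hr, ENNReal.toReal_mul,
    ENNReal.toReal_ofReal (by positivity), finrank_euclideanSpace_fin]
  rfl

theorem measureReal_ball_pos (x : Eu) {r : ℝ} (hr : 0 < r) : 0 < volume.real (ball x r) :=
  ENNReal.toReal_pos (measure_ball_pos _ _ hr).ne' measure_ball_lt_top.ne

variable {V : EuclideanSpace ℝ (Fin d) → ℝ}

theorem IsPotential.integrableOn_ball (hV : IsPotential V) (x : Eu) (r : ℝ) :
    IntegrableOn V (ball x r) :=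
  (hV.locallyIntegrable.integrableOn_isCompact (isCompact_closedBall x r)).mono_set
    ball_subset_closedBall

theorem IsPotential.aemeasurable (hV : IsPotential V) :
    AEMeasurable (fun x => ENNReal.ofReal (V x)) volume :=
  hV.locallyIntegrable.aestronglyMeasurable.aemeasurable.ennreal_ofReal

theorem IsPotential.lintegral_ball (hV : IsPotential V) (x : Eu) (r : ℝ) :
    ∫⁻ y in ball x r, ENNReal.ofReal (V y) = ENNReal.ofReal (∫ y in ball x r, V y) :=
  (ofReal_integral_eq_lintegral_ofReal (hV.integrableOn_ball x r)
    (Eventually.of_forall hV.nonneg)).symm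

/-- The `L^{d/2}` reverse Hölder inequality of a potential. -/
theorem IsPotential.reverseHolder_half (hd : 0 < d) (hV : IsPotential V) :
    ∃ C : ℝ, 0 < C ∧ ∀ (x : Eu) (r : ℝ), 0 < r →
      ((∫⁻ y in ball x r, ENNReal.ofReal (V y) ^ (d / 2 : ℝ)) / volume (ball x r)) ^
          (1 / (d / 2 : ℝ)) ≤
        ENNReal.ofReal C * ((∫⁻ y in ball x r, ENNReal.ofReal (V y)) / volume (ball x r)) := by
  obtain ⟨s, hs, C, hC, h⟩ := hV.reverseHolder
  refine ⟨C, hC, fun x r hr => ?_⟩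
  have h1 := h x r hr
  rw [setLAverage_eq] at h1
  refine le_trans ?_ h1
  have hv0 := (measure_ball_pos volume x hr).ne'
  have hvt : volume (ball x r) ≠ ∞ := measure_ball_lt_top.ne
  have : IsProbabilityMeasure ((volume (ball x r))⁻¹ • volume.restrict (ball x r)) :=
    ⟨by simp [ENNReal.inv_mul_cancel hv0 hvt]⟩
  have hd0 : (d : ℝ≥0∞) / 2 ≠ 0 := by
    simp only [ne_eq, ENNReal.div_eq_zero_iff, Nat.cast_eq_zero, not_or]
    exact ⟨hd.ne', by finiteness⟩
  have hdt : (d : ℝ≥0∞) / 2 ≠ ∞ := ENNReal.div_ne_top (by finiteness) (by norm_num)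
  have h2 := eLpNorm_le_eLpNorm_of_exponent_le hs
    (μ := (volume (ball x r))⁻¹ • volume.restrict (ball x r)) (f := V)
    ((hV.locallyIntegrable.aestronglyMeasurable.restrict).smul_measure _)
  refine le_trans (le_of_eq ?_) h2
  rw [eLpNorm_eq_lintegral_rpow_enorm_toReal hd0 hdt, lintegral_smul_measure]
  have e : ((d : ℝ≥0∞) / 2).toReal = d / 2 := by simp
  rw [e, ENNReal.div_eq_inv_mul]
  simp only [Real.enorm_of_nonneg (hV.nonneg _), smul_eq_mul]

/-- The measure with density `V^{d/2}`, on balls. -/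
noncomputable def halfPower (V : Eu → ℝ) (x : Eu) (r : ℝ) : ℝ :=
  (∫⁻ y in ball x r, ENNReal.ofReal (V y) ^ (d / 2 : ℝ)).toReal

theorem IsPotential.lintegral_halfPower_ne_top (hd : 0 < d) (hV : IsPotential V) (x : Eu)
    (r : ℝ) : ∫⁻ y in ball x r, ENNReal.ofReal (V y) ^ (d / 2 : ℝ) ≠ ∞ := by
  rcases le_or_gt r 0 with hr | hr
  · simp [ball_eq_empty.2 hr]
  obtain ⟨C, hC, h⟩ := hV.reverseHolder_half hd
  have h1 := h x r hr
  have hv0 := (measure_ball_pos volume x hr).ne'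
  have hvt : volume (ball x r) ≠ ∞ := measure_ball_lt_top.ne
  intro htop
  rw [htop, ENNReal.top_div_of_ne_top hvt, ENNReal.top_rpow_of_pos (by positivity), top_le_iff,
    hV.lintegral_ball] at h1
  exact (ENNReal.mul_ne_top (by finiteness) (ENNReal.div_ne_top (by finiteness) hv0)) h1

theorem halfPower_nonneg (V : Eu → ℝ) (x : Eu) (r : ℝ) : 0 ≤ halfPower V x r :=
  ENNReal.toReal_nonneg

theorem IsPotential.integral_nonneg (hV : IsPotential V) (E : Set Eu) : 0 ≤ ∫ y in E, V y :=
  MeasureTheory.integral_nonneg hV.nonneg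

theorem IsPotential.halfPower_mono (hd : 0 < d) (hV : IsPotential V) {x y : Eu} {r s : ℝ}
    (h : ball x r ⊆ ball y s) : halfPower V x r ≤ halfPower V y s :=
  ENNReal.toReal_mono (hV.lintegral_halfPower_ne_top hd y s) (lintegral_mono_set h)

/-- The reverse Hölder inequality after clearing volumes: |B|^{2/d} is a multiple of r², so
r^{2-d}∫V is the scale-invariant quantity in the definition of ρ. `IsPotential.integral_ball_le` is
the opposite bound. -/
theorem IsPotential.halfPower_rpow_le (hd : 0 < d) (hV : IsPotential V) :
    ∃ C : ℝ, 0 < C ∧ ∀ (x : Eu) (r : ℝ), 0 < r → halfPower V x r ^ (1 / (d / 2 : ℝ)) ≤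
      C * (r ^ 2 / r ^ d * ∫ y in ball x r, V y) := by
  obtain ⟨C, hC, h⟩ := hV.reverseHolder_half hd
  set v := volume.real (ball (0 : Eu) 1) with hv
  have hvpos : 0 < v := measureReal_ball_pos _ one_pos
  refine ⟨C * v ^ (1 / (d / 2 : ℝ)) / v, by positivity, fun x r hr => ?_⟩
  have h1 := h x r hr
  have hv0 := (measure_ball_pos volume x hr).ne'
  rw [hV.lintegral_ball] at h1
  have h2 := ENNReal.toReal_mono
    (ENNReal.mul_ne_top (by finiteness) (ENNReal.div_ne_top (by finiteness) hv0)) h1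
  rw [← ENNReal.toReal_rpow, ENNReal.toReal_div, ENNReal.toReal_mul, ENNReal.toReal_div,
    ENNReal.toReal_ofReal hC.le, ENNReal.toReal_ofReal (hV.integral_nonneg _)] at h2
  change (halfPower V x r / volume.real (ball x r)) ^ _ ≤
    C * ((∫ y in ball x r, V y) / volume.real (ball x r)) at h2
  rw [measureReal_ball hd x hr.le, ← hv, Real.div_rpow (halfPower_nonneg _ _ _) (by positivity),
    Real.mul_rpow (by positivity) hvpos.le] at h2
  have e : (r ^ d) ^ (1 / (d / 2 : ℝ)) = r ^ 2 := by
    have hd' : (d : ℝ) ≠ 0 := by exact_mod_cast hd.ne'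
    rw [← Real.rpow_natCast, ← Real.rpow_mul hr.le,
      show (d : ℝ) * (1 / (d / 2)) = (2 : ℕ) by push_cast; field_simp, Real.rpow_natCast]
  rw [e, div_le_iff₀ (by positivity)] at h2
  refine h2.trans (le_of_eq ?_)
  field_simp

/-- Hölder on E with exponent d/2. It is stated for subsets of the ball so that it can be applied to
thin annuli. -/
theorem IsPotential.setIntegral_le (hd : 3 ≤ d) (hV : IsPotential V) {x : Eu} {r : ℝ}
    {E : Set Eu} (hE : E ⊆ ball x r) :
    ∫ y in E, V y ≤ halfPower V x r ^ (1 / (d / 2 : ℝ)) *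
      volume.real E ^ (1 - 1 / (d / 2 : ℝ)) := by
  have hd' : (3 : ℝ) ≤ d := by exact_mod_cast hd
  have h1 := lintegral_rpow_le_mul_measure_univ (hV.aemeasurable.restrict (s := E)) one_pos
    (by linarith : (1 : ℝ) ≤ d / 2)
  simp only [ENNReal.rpow_one, Measure.restrict_apply_univ, div_one] at h1
  have h2 : ∫⁻ y in E, ENNReal.ofReal (V y) ^ (d / 2 : ℝ) ≤
      ∫⁻ y in ball x r, ENNReal.ofReal (V y) ^ (d / 2 : ℝ) := lintegral_mono_set hE
  have h2t := hV.lintegral_halfPower_ne_top (by omega) x r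
  have hEt : volume E ≠ ∞ := measure_ne_top_of_subset hE measure_ball_lt_top.ne
  have ha : 0 ≤ 1 - 1 / (d / 2 : ℝ) := by
    rw [sub_nonneg, div_le_one (by positivity)]
    linarith
  have h3 := h1.trans (mul_le_mul_left (ENNReal.rpow_le_rpow h2 (by positivity)) _)
  have h4 := ENNReal.toReal_mono (ENNReal.mul_ne_top
    (ENNReal.rpow_ne_top_of_nonneg (by positivity) h2t)
    (ENNReal.rpow_ne_top_of_nonneg ha hEt)) h3
  rw [ENNReal.toReal_mul, ← ENNReal.toReal_rpow, ← ENNReal.toReal_rpow,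
    ← integral_eq_lintegral_of_nonneg_ae (Eventually.of_forall hV.nonneg)
      hV.locallyIntegrable.aestronglyMeasurable.restrict] at h4
  exact h4

theorem IsPotential.integral_ball_le (hd : 3 ≤ d) (hV : IsPotential V) :
    ∃ C : ℝ, 0 < C ∧ ∀ (x : Eu) (r : ℝ), 0 < r → r ^ 2 / r ^ d * ∫ y in ball x r, V y ≤
      C * halfPower V x r ^ (1 / (d / 2 : ℝ)) := by
  set v := volume.real (ball (0 : Eu) 1) with hv
  have hvpos : 0 < v := measureReal_ball_pos _ one_pos
  refine ⟨v ^ (1 - 1 / (d / 2 : ℝ)), by positivity, fun x r hr => ?_⟩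
  have h1 := hV.setIntegral_le hd (subset_refl (ball x r))
  rw [measureReal_ball (by omega) x hr.le, ← hv, Real.mul_rpow (by positivity) hvpos.le] at h1
  have e : (r ^ d) ^ (1 - 1 / (d / 2 : ℝ)) = r ^ d / r ^ 2 := by
    have hd' : (d : ℝ) ≠ 0 := by positivity
    rw [← Real.rpow_natCast, ← Real.rpow_mul hr.le,
      show (d : ℝ) * (1 - 1 / (d / 2)) = d - (2 : ℕ) by push_cast; field_simp,
      Real.rpow_sub hr, Real.rpow_natCast, Real.rpow_natCast]
  rw [e] at h1
  have e' : r ^ 2 / r ^ d * (r ^ d / r ^ 2) = 1 := by field_simp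
  refine (mul_le_mul_of_nonneg_left h1 (by positivity : 0 ≤ r ^ 2 / r ^ d)).trans (le_of_eq ?_)
  rw [mul_left_comm, ← mul_assoc (r ^ 2 / r ^ d), e', one_mul, mul_comm]

/-- By Hölder and reverse Hölder, the annulus B(x,r) \ B(x,cr) carries at most half of the mass of
B(x,r) once c is close enough to 1. So shrinking a ball by c at most halves its mass, and finitely
many such steps shrink it below half its radius. -/
theorem IsPotential.integral_doubling (hd : 3 ≤ d) (hV : IsPotential V) :
    ∃ D : ℝ, 1 ≤ D ∧ ∀ (x : Eu) (r : ℝ), 0 < r →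
      ∫ y in ball x (2 * r), V y ≤ D * ∫ y in ball x r, V y := by
  obtain ⟨C, hC, hRH⟩ := hV.halfPower_rpow_le (by omega)
  set v := volume.real (ball (0 : Eu) 1) with hv
  have hvpos : 0 < v := measureReal_ball_pos _ one_pos
  set b : ℝ := 1 - 1 / (d / 2 : ℝ) with hb
  have hd' : (3 : ℝ) ≤ d := by exact_mod_cast hd
  have hbpos : 0 < b := by
    rw [hb, sub_pos, div_lt_one (by positivity)]
    linarith
  have hlim : Tendsto (fun c : ℝ => C * v ^ b * (1 - c ^ d) ^ b) (𝓝[<] 1) (𝓝 0) := by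
    have hc : ContinuousAt (fun c : ℝ => C * v ^ b * (1 - c ^ d) ^ b) 1 := by
      refine continuousAt_const.mul (ContinuousAt.rpow_const (by fun_prop) (Or.inr hbpos.le))
    have := hc.tendsto
    simp only [one_pow, sub_self, Real.zero_rpow hbpos.ne', mul_zero] at this
    exact this.mono_left nhdsWithin_le_nhds
  obtain ⟨c, hc, hc0, hc1⟩ := ((hlim.eventually (ge_mem_nhds (by norm_num : (0 : ℝ) < 1 / 2))).and
    (Ioo_mem_nhdsLT (zero_lt_one' ℝ))).exists
  have hstep : ∀ (x : Eu) (r : ℝ), 0 < r →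
      ∫ y in ball x r, V y ≤ 2 * ∫ y in ball x (c * r), V y := by
    intro x r hr
    have hsub : ball x (c * r) ⊆ ball x r := ball_subset_ball (by nlinarith)
    have hE := hV.setIntegral_le hd (sdiff_subset : ball x r \ ball x (c * r) ⊆ ball x r)
    have hvol : volume.real (ball x r \ ball x (c * r)) = r ^ d * (v * (1 - c ^ d)) := by
      rw [measureReal_sdiff hsub measurableSet_ball, measureReal_ball (by omega) x hr.le,
        measureReal_ball (by omega) x (by positivity), mul_pow]
      ring
    have hcd : 0 ≤ 1 - c ^ d := sub_nonneg.2 (pow_le_one₀ hc0.le hc1.le)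
    have e : (r ^ d) ^ b = r ^ d / r ^ 2 := by
      rw [hb, ← Real.rpow_natCast, ← Real.rpow_mul hr.le,
        show (d : ℝ) * (1 - 1 / (d / 2)) = d - (2 : ℕ) by push_cast; field_simp,
        Real.rpow_sub hr, Real.rpow_natCast, Real.rpow_natCast]
    rw [hvol, Real.mul_rpow (by positivity) (by positivity), Real.mul_rpow hvpos.le hcd, e] at hE
    have hI := hV.integral_nonneg (ball x r)
    have hhalf : ∫ y in ball x r \ ball x (c * r), V y ≤ 1 / 2 * ∫ y in ball x r, V y := by
      calc _ ≤ C * (r ^ 2 / r ^ d * ∫ y in ball x r, V y) *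
            (r ^ d / r ^ 2 * (v ^ b * (1 - c ^ d) ^ b)) := by
            refine hE.trans ?_
            gcongr
            exact hRH x r hr
        _ = (C * v ^ b * (1 - c ^ d) ^ b) * ∫ y in ball x r, V y := by field_simp
        _ ≤ _ := by gcongr
    have hadd := setIntegral_sdiff measurableSet_ball (hV.integrableOn_ball x r) hsub
    linarith
  obtain ⟨k, hk⟩ := exists_pow_lt_of_lt_one (by norm_num : (0 : ℝ) < 1 / 2) hc1
  have hiter : ∀ (n : ℕ) (x : Eu) (r : ℝ), 0 < r →
      ∫ y in ball x r, V y ≤ 2 ^ n * ∫ y in ball x (c ^ n * r), V y := by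
    intro n
    induction n with
    | zero => intro x r _; simp
    | succ n ih =>
      intro x r hr
      calc ∫ y in ball x r, V y ≤ 2 * ∫ y in ball x (c * r), V y := hstep x r hr
        _ ≤ 2 * (2 ^ n * ∫ y in ball x (c ^ n * (c * r)), V y) := by
          gcongr
          exact ih x (c * r) (by positivity)
        _ = _ := by rw [pow_succ, pow_succ, mul_assoc (c ^ n)]; ring
  refine ⟨2 ^ k, one_le_pow₀ (by norm_num), fun x r hr => ?_⟩
  refine (hiter k x (2 * r) (by positivity)).trans ?_
  refine mul_le_mul_of_nonneg_left (setIntegral_mono_set (hV.integrableOn_ball x r)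
    (Eventually.of_forall hV.nonneg) (LE.le.eventuallyLE (ball_subset_ball ?_))) (by positivity)
  nlinarith

/-- If V had no mass on one ball, doubling would remove it from all concentric larger balls, and V
would vanish almost everywhere. -/
theorem IsPotential.integral_ball_pos (hd : 3 ≤ d) (hV : IsPotential V) (x : Eu) {r : ℝ}
    (hr : 0 < r) : 0 < ∫ y in ball x r, V y := by
  refine (hV.integral_nonneg _).lt_of_ne' fun h0 => hV.ne_zero ?_
  obtain ⟨D, hD, h⟩ := hV.integral_doubling hd
  have hz : ∀ k : ℕ, ∫ y in ball x (2 ^ k * r), V y = 0 := by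
    intro k
    induction k with
    | zero => simpa using h0
    | succ k ih =>
      refine le_antisymm ?_ (hV.integral_nonneg _)
      have := h x (2 ^ k * r) (by positivity)
      rw [ih, mul_zero] at this
      rwa [pow_succ', mul_assoc]
  have hz' : ∀ k : ℕ, ∀ᵐ y, y ∈ ball x (2 ^ k * r) → V y = 0 := by
    intro k
    have := (setIntegral_eq_zero_iff_of_nonneg_ae (Eventually.of_forall hV.nonneg)
      (hV.integrableOn_ball x _)).1 (hz k)
    exact (ae_restrict_iff' measurableSet_ball).1 this
  filter_upwards [ae_all_iff.2 hz'] with y hy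
  obtain ⟨k, hk⟩ := pow_unbounded_of_one_lt (dist y x / r) (one_lt_two (α := ℝ))
  exact hy k (by rw [mem_ball]; exact (div_lt_iff₀ hr).1 hk)

theorem IsPotential.halfPower_pos (hd : 3 ≤ d) (hV : IsPotential V) (x : Eu) {r : ℝ}
    (hr : 0 < r) : 0 < halfPower V x r := by
  refine (halfPower_nonneg V x r).lt_of_ne' fun h0 => ?_
  have h1 := hV.setIntegral_le hd (subset_refl (ball x r))
  have hd' : (3 : ℝ) ≤ d := by exact_mod_cast hd
  rw [h0, Real.zero_rpow (by positivity), zero_mul] at h1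
  exact absurd h1 (not_le.2 (hV.integral_ball_pos hd x hr))

/-- Doubling passes from ∫V to ∫V^{d/2} through the two-sided comparison of r^{2-d}∫V with
(∫V^{d/2})^{2/d}. -/
theorem IsPotential.halfPower_doubling (hd : 3 ≤ d) (hV : IsPotential V) :
    ∃ D : ℝ, 2 ≤ D ∧ ∀ (x : Eu) (r : ℝ), 0 < r → halfPower V x (2 * r) ≤ D * halfPower V x r := by
  obtain ⟨C, hC, h1⟩ := hV.halfPower_rpow_le (by omega)
  obtain ⟨C', hC', h2⟩ := hV.integral_ball_le hd
  obtain ⟨D, hD, h3⟩ := hV.integral_doubling hd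
  set a : ℝ := 1 / (d / 2 : ℝ) with ha
  have hapos : 0 < a := by positivity
  refine ⟨max 2 ((C * (2 ^ 2 / 2 ^ d * D * C')) ^ (1 / a)), le_max_left _ _, fun x r hr => ?_⟩
  have hm := hV.halfPower_pos hd x hr
  have hm2 := hV.halfPower_pos hd x (r := 2 * r) (by positivity)
  have key : halfPower V x (2 * r) ^ a ≤
      C * (2 ^ 2 / 2 ^ d * D * C') * halfPower V x r ^ a := by
    calc _ ≤ C * ((2 * r) ^ 2 / (2 * r) ^ d * ∫ y in ball x (2 * r), V y) :=
          h1 x _ (by positivity)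
      _ ≤ C * ((2 * r) ^ 2 / (2 * r) ^ d * (D * ∫ y in ball x r, V y)) := by
          gcongr
          exact h3 x r hr
      _ = C * (2 ^ 2 / 2 ^ d * D * (r ^ 2 / r ^ d * ∫ y in ball x r, V y)) := by
          rw [mul_pow, mul_pow]; field_simp
      _ ≤ C * (2 ^ 2 / 2 ^ d * D * (C' * halfPower V x r ^ a)) := by
          have := h2 x r hr
          exact mul_le_mul_of_nonneg_left (mul_le_mul_of_nonneg_left this (by positivity)) hC.le
      _ = _ := by ring
  calc halfPower V x (2 * r) = (halfPower V x (2 * r) ^ a) ^ (1 / a) := by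
        rw [← Real.rpow_mul hm2.le, mul_one_div_cancel hapos.ne', Real.rpow_one]
    _ ≤ (C * (2 ^ 2 / 2 ^ d * D * C') * halfPower V x r ^ a) ^ (1 / a) := by gcongr
    _ = (C * (2 ^ 2 / 2 ^ d * D * C')) ^ (1 / a) * halfPower V x r := by
        rw [Real.mul_rpow (by positivity) (by positivity), ← Real.rpow_mul hm.le,
          mul_one_div_cancel hapos.ne', Real.rpow_one]
    _ ≤ _ := by gcongr; exact le_max_right _ _

/-- The ball B(x,4r) also contains a disjoint ball B(y,r) with |x - y| = 2r. As B(x,r) lies in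
B(y,4r), two doublings show that this second ball carries at least the fraction D⁻² of the mass of
the first. -/
theorem IsPotential.halfPower_reverse_doubling (hd : 3 ≤ d) (hV : IsPotential V) :
    ∃ A : ℝ, 1 < A ∧ ∀ (x : Eu) (r : ℝ), 0 < r → A * halfPower V x r ≤ halfPower V x (4 * r) := by
  obtain ⟨D, hD, h⟩ := hV.halfPower_doubling hd
  have hDpos : 0 < D := by linarith
  refine ⟨1 + 1 / D ^ 2, by simp; positivity, fun x r hr => ?_⟩
  set y : Eu := x + EuclideanSpace.single ⟨0, by omega⟩ (2 * r) with hy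
  have hxy : dist x y = 2 * r := by
    rw [dist_eq_norm, hy, sub_add_cancel_left, norm_neg, PiLp.norm_single, Real.norm_eq_abs,
      abs_of_pos (by positivity)]
  have hdisj : Disjoint (ball x r) (ball y r) := ball_disjoint_ball (by linarith)
  have hsub : ball x r ∪ ball y r ⊆ ball x (4 * r) := union_subset (ball_subset_ball (by linarith))
    (ball_subset_ball' (by rw [dist_comm]; linarith))
  have hadd : halfPower V x r + halfPower V y r ≤ halfPower V x (4 * r) := by
    unfold halfPower
    rw [← ENNReal.toReal_add (hV.lintegral_halfPower_ne_top (by omega) x r)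
      (hV.lintegral_halfPower_ne_top (by omega) y r), ← lintegral_union measurableSet_ball hdisj]
    exact ENNReal.toReal_mono (hV.lintegral_halfPower_ne_top (by omega) _ _)
      (lintegral_mono_set hsub)
  have h4 : halfPower V x r ≤ D ^ 2 * halfPower V y r := by
    calc halfPower V x r ≤ halfPower V y (2 * (2 * r)) :=
          hV.halfPower_mono (by omega) (ball_subset_ball' (by linarith))
      _ ≤ D * halfPower V y (2 * r) := h y _ (by positivity)
      _ ≤ D * (D * halfPower V y r) := by gcongr; exact h y r hr
      _ = _ := by ring
  have h5 : 1 / D ^ 2 * halfPower V x r ≤ halfPower V y r := by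
    rw [one_div_mul_eq_div, div_le_iff₀ (by positivity)]
    linarith
  linarith

theorem IsPotential.criticalRadius_pos_and_slowVariation (hd : 3 ≤ d) (hV : IsPotential V) :
    (∀ x, 0 < criticalRadius V x) ∧ ∃ C₀ N₀, SlowVariation (criticalRadius V) C₀ N₀ := by
  obtain ⟨D, hD, hDm⟩ := hV.halfPower_doubling hd
  obtain ⟨A, hA, hAm⟩ := hV.halfPower_reverse_doubling hd
  obtain ⟨c₁, hc₁, h₁⟩ := hV.integral_ball_le hd
  obtain ⟨c₂, hc₂, h₂⟩ := hV.halfPower_rpow_le (by omega)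
  have e : ∀ r : ℝ, 0 < r → 1 / r ^ (d - 2) = r ^ 2 / r ^ d := by
    intro r hr
    rw [div_eq_div_iff (by positivity) (by positivity), one_mul, ← pow_add]
    congr 1
    omega
  refine slowVariation_of_doubling (m := halfPower V)
    (h := fun x r => 1 / r ^ (d - 2) * ∫ y in ball x r, V y)
    (fun x y r s h => hV.halfPower_mono (by omega) h) (fun x r hr => hV.halfPower_pos hd x hr)
    hD hDm hA hAm (by positivity : 0 < 1 / (d / 2 : ℝ)) hc₁ hc₂ ?_ ?_
  · intro x r hr
    rw [e r hr]
    exact h₁ x r hr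
  · intro x r hr
    rw [e r hr]
    exact h₂ x r hr

end Potential

/-! ### The A_{p,q} condition: positivity, finiteness and Hölder's inequality. -/

section Weights

open Set Filter Topology Metric

variable {d : ℕ}

local notation "Eu" => EuclideanSpace ℝ (Fin d)

/-- The dual factor in the `A_{p,q}` condition over the set `B`. -/
noncomputable def dualFactor (p : ℝ) (ω : Eu → ℝ) (B : Set Eu) : ℝ≥0∞ :=
  if p = 1 then (essInf (fun x => ENNReal.ofReal (ω x)) (volume.restrict B))⁻¹
  else (⨍⁻ x in B, ENNReal.ofReal (ω x) ^ (-(p / (p - 1))) ∂volume) ^ (1 / (p / (p - 1)))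

variable {ρ ω : EuclideanSpace ℝ (Fin d) → ℝ} {p q θ : ℝ}

theorem IsWeight.aemeasurable (hω : IsWeight ω) :
    AEMeasurable (fun x => ENNReal.ofReal (ω x)) volume :=
  hω.locallyIntegrable.aestronglyMeasurable.aemeasurable.ennreal_ofReal

theorem apqConst_ball (hρ : ∀ x, 0 < ρ x) (ω : Eu → ℝ) (p q θ : ℝ) (x : Eu) {r : ℝ}
    (hr : 0 < r) :
    (weightPow ω q (ball x r) / volume (ball x r)) ^ (1 / q) * dualFactor p ω (ball x r) ≤
      apqConst ρ θ p q ω * ENNReal.ofReal ((1 + r / ρ x) ^ θ) := by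
  have h : ENNReal.ofReal ((1 + r / ρ x) ^ (-θ)) *
      (weightPow ω q (ball x r) / volume (ball x r)) ^ (1 / q) * dualFactor p ω (ball x r) ≤
      apqConst ρ θ p q ω := by
    refine le_iSup_of_le x (le_iSup_of_le r (le_iSup_of_le hr ?_))
    unfold weightPow dualFactor
    rw [← setLAverage_eq]
  have hpos : 0 < 1 + r / ρ x := by have := hρ x; positivity
  calc _ = (ENNReal.ofReal ((1 + r / ρ x) ^ (-θ)) * ENNReal.ofReal ((1 + r / ρ x) ^ θ)) *
        ((weightPow ω q (ball x r) / volume (ball x r)) ^ (1 / q) *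
          dualFactor p ω (ball x r)) := by
        rw [← ENNReal.ofReal_mul (by positivity), ← Real.rpow_add hpos]
        simp
    _ = (ENNReal.ofReal ((1 + r / ρ x) ^ (-θ)) *
        (weightPow ω q (ball x r) / volume (ball x r)) ^ (1 / q) * dualFactor p ω (ball x r)) *
          ENNReal.ofReal ((1 + r / ρ x) ^ θ) := by ring
    _ ≤ _ := by gcongr

/-- The weight takes finite values, so ω⁻¹ does not vanish. In the A_{p,q} product this forces the
ω^q average to be finite. -/
theorem dualFactor_ne_zero (hp : 1 ≤ p) (hω : IsWeight ω) {x : Eu} {r : ℝ} (hr : 0 < r) :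
    dualFactor p ω (ball x r) ≠ 0 := by
  have hv0 := (measure_ball_pos volume x hr).ne'
  have hvt : volume (ball x r) ≠ ∞ := measure_ball_lt_top.ne
  unfold dualFactor
  split_ifs with h1
  · rw [ENNReal.inv_ne_zero]
    intro htop
    have h2 : ∀ᵐ y ∂volume.restrict (ball x r), False := by
      filter_upwards [ae_essInf_le (μ := volume.restrict (ball x r))
        (f := fun x => ENNReal.ofReal (ω x))] with y hy
      rw [htop, top_le_iff] at hy
      exact ENNReal.ofReal_ne_top hy
    simp only [eventually_false_iff_eq_bot, ae_eq_bot, Measure.restrict_eq_zero] at h2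
    exact hv0 h2
  · have hp1 : 0 < p - 1 := sub_pos.2 (lt_of_le_of_ne hp (Ne.symm h1))
    have hp' : 0 < p / (p - 1) := by positivity
    rw [setLAverage_eq, ne_eq, ENNReal.rpow_eq_zero_iff_of_pos (by positivity),
      ENNReal.div_eq_zero_iff, not_or]
    refine ⟨fun h0 => ?_, hvt⟩
    rw [lintegral_eq_zero_iff' (hω.aemeasurable.restrict.pow_const _)] at h0
    have h2 : ∀ᵐ y ∂volume.restrict (ball x r), False := by
      filter_upwards [h0] with y hy
      simp only [Pi.zero_apply, ENNReal.rpow_eq_zero_iff] at hy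
      rcases hy with ⟨_, hy⟩ | ⟨hy, _⟩
      · linarith
      · exact ENNReal.ofReal_ne_top hy
    simp only [eventually_false_iff_eq_bot, ae_eq_bot, Measure.restrict_eq_zero] at h2
    exact hv0 h2

theorem weightPow_eq_zero_iff (hω : IsWeight ω) (hq : 0 < q) (E : Set Eu) :
    weightPow ω q E = 0 ↔ ∀ᵐ x ∂volume.restrict E, ω x = 0 := by
  unfold weightPow
  rw [lintegral_eq_zero_iff' (hω.aemeasurable.restrict.pow_const _)]
  refine eventually_congr (Eventually.of_forall fun x => ?_)
  simp only [Pi.zero_apply, ENNReal.rpow_eq_zero_iff_of_pos hq, ENNReal.ofReal_eq_zero]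
  exact ⟨fun h => le_antisymm h (hω.nonneg x), fun h => h.le⟩

theorem MemApq.apq_mul_ne_top (h : MemApq ρ θ p q ω) (t : ℝ) :
    apqConst ρ θ p q ω * ENNReal.ofReal t ≠ ∞ :=
  ENNReal.mul_ne_top h.2.ne ENNReal.ofReal_ne_top

/-- A weight in `A_{p,q}` is positive almost everywhere. -/
theorem MemApq.ae_pos (hρ : ∀ x, 0 < ρ x) (hp : 1 ≤ p) (hq : 0 < q)
    (h : MemApq ρ θ p q ω) : ∀ᵐ x, 0 < ω x := by
  have hω := h.1
  have hex : ∃ n : ℕ, weightPow ω q (ball (0 : Eu) (n + 1)) ≠ 0 := by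
    by_contra! hcon
    apply hω.ne_zero
    have h1 : ∀ n : ℕ, ∀ᵐ x, x ∈ ball (0 : Eu) (n + 1) → ω x = 0 := fun n =>
      (ae_restrict_iff' measurableSet_ball).1 ((weightPow_eq_zero_iff hω hq _).1 (hcon n))
    filter_upwards [ae_all_iff.2 h1] with x hx
    obtain ⟨n, hn⟩ := exists_nat_gt ‖x‖
    exact hx n (by rw [mem_ball_zero_iff]; linarith)
  obtain ⟨n₀, hn₀⟩ := hex
  have h1 : ∀ n : ℕ, ∀ᵐ x, x ∈ ball (0 : Eu) (n₀ + 1 + n) → 0 < ω x := by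
    intro n
    have hr : (0 : ℝ) < n₀ + 1 + n := by positivity
    have hv0 := (measure_ball_pos volume (0 : Eu) hr).ne'
    have hvt : volume (ball (0 : Eu) (n₀ + 1 + n)) ≠ ∞ := measure_ball_lt_top.ne
    have h2 := apqConst_ball hρ ω p q θ 0 hr
    -- These balls contain one with positive ω^q mass, so the first factor of the A_{p,q} product is
    -- nonzero and the dual factor must be finite. That excludes zeros of ω on a set of positive
    -- measure.
    have h3 : dualFactor p ω (ball (0 : Eu) (n₀ + 1 + n)) ≠ ∞ := by
      intro htop
      rw [htop, ENNReal.mul_top, top_le_iff] at h2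
      · exact h.apq_mul_ne_top _ h2
      · have h4 : weightPow ω q (ball (0 : Eu) (n₀ + 1 + n)) ≠ 0 := fun h0 => hn₀
          (le_antisymm ((lintegral_mono_set (ball_subset_ball
            (by linarith [n.cast_nonneg (α := ℝ)]))).trans h0.le) bot_le)
        rw [ne_eq, ENNReal.rpow_eq_zero_iff_of_pos (by positivity), ENNReal.div_eq_zero_iff, not_or]
        exact ⟨h4, hvt⟩
    rw [← ae_restrict_iff' measurableSet_ball]
    unfold dualFactor at h3
    split_ifs at h3 with hp1
    · rw [ne_eq, ENNReal.inv_eq_top] at h3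
      filter_upwards [ae_essInf_le (μ := volume.restrict (ball (0 : Eu) (n₀ + 1 + n)))
        (f := fun x => ENNReal.ofReal (ω x))] with y hy
      exact ENNReal.ofReal_pos.1 ((pos_iff_ne_zero.2 h3).trans_le hy)
    · have hp2 : 0 < p - 1 := sub_pos.2 (lt_of_le_of_ne hp (Ne.symm hp1))
      have hp' : 0 < p / (p - 1) := by positivity
      rw [setLAverage_eq, ne_eq, ENNReal.rpow_eq_top_iff_of_pos (by positivity)] at h3
      have h4 : ∫⁻ x in ball (0 : Eu) (n₀ + 1 + n),
          ENNReal.ofReal (ω x) ^ (-(p / (p - 1))) ≠ ∞ := by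
        intro htop
        rw [htop, ENNReal.top_div_of_ne_top hvt] at h3
        exact h3 rfl
      filter_upwards [ae_lt_top' (hω.aemeasurable.restrict.pow_const _) h4] with y hy
      refine (hω.nonneg y).lt_of_ne' fun h0 => ?_
      rw [h0, ENNReal.ofReal_zero, ENNReal.zero_rpow_of_neg (by linarith)] at hy
      exact lt_irrefl _ hy
  filter_upwards [ae_all_iff.2 h1] with x hx
  obtain ⟨n, hn⟩ := exists_nat_gt ‖x‖
  exact hx n (by rw [mem_ball_zero_iff]; linarith [n₀.cast_nonneg (α := ℝ)])

theorem MemApq.weightPow_ne_zero (hρ : ∀ x, 0 < ρ x) (hp : 1 ≤ p) (hq : 0 < q)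
    (h : MemApq ρ θ p q ω) {γ : ℝ} (hγ : 0 < γ) {E : Set Eu} (hE : volume E ≠ 0) :
    weightPow ω γ E ≠ 0 := by
  rw [ne_eq, weightPow_eq_zero_iff h.1 hγ]
  intro h0
  have h2 : ∀ᵐ y ∂volume.restrict E, False := by
    filter_upwards [h0, ae_restrict_of_ae (h.ae_pos hρ hp hq)] with y hy hy'
    exact hy'.ne' hy
  simp only [eventually_false_iff_eq_bot, ae_eq_bot, Measure.restrict_eq_zero] at h2
  exact hE h2

theorem MemApq.weightPow_ball_ne_top (hρ : ∀ x, 0 < ρ x) (hp : 1 ≤ p) (hq : 0 < q)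
    (h : MemApq ρ θ p q ω) (x : Eu) {r : ℝ} (hr : 0 < r) : weightPow ω q (ball x r) ≠ ∞ := by
  intro htop
  have h2 := apqConst_ball hρ ω p q θ x hr
  rw [htop, ENNReal.top_div_of_ne_top measure_ball_lt_top.ne,
    ENNReal.top_rpow_of_pos (by positivity), ENNReal.top_mul (dualFactor_ne_zero hp h.1 hr),
    top_le_iff] at h2
  exact h.apq_mul_ne_top _ h2

theorem MemApq.weightPow_cube_ne_top (hd : 0 < d) (hρ : ∀ x, 0 < ρ x) (hp : 1 ≤ p) (hq : 0 < q)
    (h : MemApq ρ θ p q ω) (x : Eu) {r : ℝ} (hr : 0 < r) : weightPow ω q (cube x r) ≠ ∞ :=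
  ne_top_of_le_ne_top
    (h.weightPow_ball_ne_top hρ hp hq x (r := d * r) (by positivity))
    (lintegral_mono_set (cube_subset_ball hd x hr))

/-- Hölder's inequality against the dual factor. -/
theorem setLIntegral_le_mul_dualFactor (hω : IsWeight ω) (hpos : ∀ᵐ x, 0 < ω x) (hp : 1 ≤ p)
    {B F : Set Eu} (hB0 : volume B ≠ 0) (hBt : volume B ≠ ∞) (hF : F ⊆ B) {G : Eu → ℝ≥0∞}
    (hG : AEMeasurable G (volume.restrict F)) :
    ∫⁻ x in F, G x ≤ (∫⁻ x in F, (G x * ENNReal.ofReal (ω x)) ^ p) ^ (1 / p) *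
      (volume B ^ (1 - 1 / p) * dualFactor p ω B) := by
  have hw := hω.aemeasurable
  have hmul : ∫⁻ x in F, G x =
      ∫⁻ x in F, (G x * ENNReal.ofReal (ω x)) * (ENNReal.ofReal (ω x))⁻¹ := by
    refine lintegral_congr_ae ?_
    filter_upwards [ae_restrict_of_ae hpos] with x hx
    rw [mul_assoc, ENNReal.mul_inv_cancel (by simpa using hx) ENNReal.ofReal_ne_top, mul_one]
  rw [hmul]
  unfold dualFactor
  split_ifs with h1
  · subst h1
    simp only [div_one, ENNReal.rpow_one, sub_self, ENNReal.rpow_zero, one_mul]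
    have hGw : AEMeasurable (fun x => G x * ENNReal.ofReal (ω x)) (volume.restrict F) :=
      hG.mul hw.restrict
    rw [← lintegral_mul_const'' _ hGw]
    refine lintegral_mono_ae ?_
    filter_upwards [ae_restrict_of_ae_restrict_of_subset hF
      (ae_essInf_le (μ := volume.restrict B) (f := fun x => ENNReal.ofReal (ω x)))] with x hx
    gcongr
  · have hp1 : 1 < p := lt_of_le_of_ne hp (Ne.symm h1)
    have hp2 : 0 < p - 1 := sub_pos.2 hp1
    have hconj := Real.HolderConjugate.conjExponent hp1
    have h2 := ENNReal.lintegral_mul_le_Lp_mul_Lq (volume.restrict F) hconj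
      (hG.mul hw.restrict) hw.restrict.inv
    refine h2.trans (mul_le_mul_right ?_ _)
    have h3 : ∫⁻ x in F, (fun x => ENNReal.ofReal (ω x))⁻¹ x ^ (p / (p - 1)) ≤
        volume B * ⨍⁻ x in B, ENNReal.ofReal (ω x) ^ (-(p / (p - 1))) ∂volume := by
      rw [setLAverage_eq, ENNReal.mul_div_cancel hB0 hBt]
      refine (lintegral_mono_set hF).trans (le_of_eq ?_)
      simp only [Pi.inv_apply, ENNReal.inv_rpow, ENNReal.rpow_neg]
    calc _ ≤ (volume B * ⨍⁻ x in B, ENNReal.ofReal (ω x) ^ (-(p / (p - 1))) ∂volume) ^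
          (1 / (p / (p - 1))) := ENNReal.rpow_le_rpow h3 (by positivity)
      _ = _ := by
        rw [ENNReal.mul_rpow_of_nonneg _ _ (by positivity)]
        congr 2
        field_simp

/-- The factor lost when passing from balls to cubes in the `A_{p,q}` condition. -/
noncomputable def cubeFactor (d : ℕ) (p q θ : ℝ) : ℝ :=
  ((2 * d : ℝ) ^ d) ^ (1 - 1 / p + 1 / q) * (d : ℝ) ^ θ

theorem cubeFactor_pos (hd : 0 < d) (p q θ : ℝ) : 0 < cubeFactor d p q θ := by
  unfold cubeFactor
  positivity

/-- Hölder against the dual factor, multiplied by ω^q(Q)^{1/q} so that the full A_{p,q} product on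
B(c, dr) appears. Used with G = 1 on subsets (A_∞ condition), G = 1 on Q (forward bound) and G the
lower oscillation (converse). -/
theorem MemApq.setLIntegral_mul_le (hd : 0 < d) (hρ : ∀ x, 0 < ρ x) (hp : 1 ≤ p) (hq : 0 < q)
    (hθ : 0 < θ) (h : MemApq ρ θ p q ω) (c : Eu) {r : ℝ} (hr : 0 < r) {F : Set Eu}
    (hF : F ⊆ cube c r) {G : Eu → ℝ≥0∞} (hG : AEMeasurable G (volume.restrict F)) :
    (∫⁻ x in F, G x) * weightPow ω q (cube c r) ^ (1 / q) ≤
      (∫⁻ x in F, (G x * ENNReal.ofReal (ω x)) ^ p) ^ (1 / p) *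
        (volume (cube c r) ^ (1 - 1 / p + 1 / q) * ENNReal.ofReal (cubeFactor d p q θ) *
          apqConst ρ θ p q ω * ENNReal.ofReal ((1 + r / ρ c) ^ θ)) := by
  have hd1 : (1 : ℝ) ≤ d := by exact_mod_cast hd
  set B := ball c (d * r) with hB
  have hQB : cube c r ⊆ B := cube_subset_ball hd c hr
  have hr' : 0 < d * r := by positivity
  have hB0 : volume B ≠ 0 := (measure_ball_pos volume c hr').ne'
  have hBt : volume B ≠ ∞ := measure_ball_lt_top.ne
  have h1 := setLIntegral_le_mul_dualFactor h.1 (h.ae_pos hρ hp hq) hp hB0 hBt (hF.trans hQB) hG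
  have h2 : weightPow ω q (cube c r) ^ (1 / q) ≤
      volume B ^ (1 / q) * (weightPow ω q B / volume B) ^ (1 / q) := by
    rw [← ENNReal.mul_rpow_of_nonneg _ _ (by positivity), ENNReal.mul_div_cancel hB0 hBt]
    exact ENNReal.rpow_le_rpow (lintegral_mono_set hQB) (by positivity)
  have hρc := hρ c
  have h3 : ENNReal.ofReal ((1 + d * r / ρ c) ^ θ) ≤
      ENNReal.ofReal (d ^ θ) * ENNReal.ofReal ((1 + r / ρ c) ^ θ) := by
    rw [← ENNReal.ofReal_mul (by positivity), ← Real.mul_rpow (by positivity) (by positivity)]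
    refine ENNReal.ofReal_le_ofReal (Real.rpow_le_rpow (by positivity) ?_ hθ.le)
    rw [mul_add, mul_one, mul_div_assoc]
    gcongr
  have he : 0 ≤ 1 - 1 / p := by
    rw [sub_nonneg, div_le_one (by linarith)]; exact hp
  have he' : 0 ≤ 1 - 1 / p + 1 / q := by positivity
  have h4 : volume B ^ (1 - 1 / p + 1 / q) ≤
      ENNReal.ofReal (((2 * d : ℝ) ^ d) ^ (1 - 1 / p + 1 / q)) * volume (cube c r) ^ (1 - 1 / p + 1 / q) := by
    rw [← ENNReal.ofReal_rpow_of_nonneg (by positivity) he', ← ENNReal.mul_rpow_of_nonneg _ _ he']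
    exact ENNReal.rpow_le_rpow (volume_ball_le_cube c r) he'
  calc _ ≤ ((∫⁻ x in F, (G x * ENNReal.ofReal (ω x)) ^ p) ^ (1 / p) *
          (volume B ^ (1 - 1 / p) * dualFactor p ω B)) *
          (volume B ^ (1 / q) * (weightPow ω q B / volume B) ^ (1 / q)) := by gcongr
    _ = (∫⁻ x in F, (G x * ENNReal.ofReal (ω x)) ^ p) ^ (1 / p) *
          (volume B ^ (1 - 1 / p + 1 / q) *
            ((weightPow ω q B / volume B) ^ (1 / q) * dualFactor p ω B)) := by
        rw [ENNReal.rpow_add _ _ hB0 hBt]; ring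
    _ ≤ (∫⁻ x in F, (G x * ENNReal.ofReal (ω x)) ^ p) ^ (1 / p) *
          ((ENNReal.ofReal (((2 * d : ℝ) ^ d) ^ (1 - 1 / p + 1 / q)) *
            volume (cube c r) ^ (1 - 1 / p + 1 / q)) *
            (apqConst ρ θ p q ω * (ENNReal.ofReal (d ^ θ) *
              ENNReal.ofReal ((1 + r / ρ c) ^ θ)))) := by
        have h5 := (apqConst_ball hρ ω p q θ c hr').trans (mul_le_mul_right h3 _)
        exact mul_le_mul_right (mul_le_mul' h4 h5) _
    _ = _ := by
        rw [cubeFactor, ENNReal.ofReal_mul (by positivity)]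
        ring

theorem IsWeight.weightPow_rpow_le (hω : IsWeight ω) (hp : 0 < p) (hpq : p ≤ q) (E : Set Eu) :
    weightPow ω p E ^ (1 / p) ≤ weightPow ω q E ^ (1 / q) * volume E ^ (1 / p - 1 / q) := by
  have h := lintegral_rpow_le_mul_measure_univ (hω.aemeasurable.restrict (s := E)) hp hpq
  rwa [Measure.restrict_apply_univ] at h

end Weights

/-! ### From A_{p,q} to the comparison (b) of ω^q with Lebesgue measure. -/

section Comparison

open Set Filter Topology Metric

variable {d : ℕ}

local notation "Eu" => EuclideanSpace ℝ (Fin d)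

/-- If E fills at most half of P, its complement fills at least half and so carries at least 1/A of
the measure. -/
theorem measure_le_of_two_mul_le {ν : Measure Eu} {P E : Set Eu} {A : ℝ} (hA : 2 ≤ A)
    (hP : MeasurableSet P) (hPt : volume P ≠ ∞) (hνP : ν P ≠ ∞)
    (H : ∀ F, MeasurableSet F → F ⊆ P → volume P ≤ 2 * volume F → ν P ≤ ENNReal.ofReal A * ν F)
    (hE : MeasurableSet E) (hEP : E ⊆ P) (hvol : 2 * volume E ≤ volume P) :
    ν E ≤ ENNReal.ofReal (1 - 1 / A) * ν P := by
  have hApos : 0 < A := by linarith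
  have h1 : volume E + volume (P \ E) = volume P := by
    rw [measure_add_sdiff hE.nullMeasurableSet, union_eq_self_of_subset_left hEP]
  have h2 : ν E + ν (P \ E) = ν P := by
    rw [measure_add_sdiff hE.nullMeasurableSet, union_eq_self_of_subset_left hEP]
  have h3 : volume P ≤ 2 * volume (P \ E) := by
    have : volume P + volume P ≤ volume P + 2 * volume (P \ E) := by
      calc volume P + volume P = 2 * volume E + 2 * volume (P \ E) := by
            rw [← mul_add, h1, two_mul]
        _ ≤ _ := by gcongr
    exact (ENNReal.add_le_add_iff_left hPt).1 this
  have h4 := H _ (hP.diff hE) sdiff_subset h3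
  have hEt : ν E ≠ ∞ := ne_top_of_le_ne_top hνP (measure_mono hEP)
  have hFt : ν (P \ E) ≠ ∞ := ne_top_of_le_ne_top hνP (measure_mono sdiff_subset)
  have h5 : 0 ≤ 1 - 1 / A := by
    rw [sub_nonneg, div_le_one hApos]; linarith
  rw [← ENNReal.toReal_le_toReal hEt (ENNReal.mul_ne_top ENNReal.ofReal_ne_top hνP),
    ENNReal.toReal_mul, ENNReal.toReal_ofReal h5]
  have h6 := ENNReal.toReal_mono (ENNReal.mul_ne_top ENNReal.ofReal_ne_top hFt) h4
  rw [ENNReal.toReal_mul, ENNReal.toReal_ofReal hApos.le] at h6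
  have h7 := congrArg ENNReal.toReal h2
  rw [ENNReal.toReal_add hEt hFt] at h7
  have h8 : (ν P).toReal / A ≤ (ν (P \ E)).toReal := by
    rw [div_le_iff₀ hApos]; linarith
  rw [sub_mul, one_mul, one_div_mul_eq_div]
  linarith

/-- Geometric decay: a measure which satisfies a dyadic `A_∞` condition on the subcubes of a
cube is small on small subsets of that cube. -/
theorem measure_le_pow_mul (hd : 0 < d) {ν : Measure Eu} (hν : ν ≪ volume) {c : Eu} {r : ℝ}
    (hr : 0 < r) {A : ℝ} (hA : 2 ≤ A) (hfin : ν (hcube c r) ≠ ∞)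
    (H : ∀ (x : Eu) (s : ℝ), 0 < s → hcube x s ⊆ hcube c r → ∀ F, MeasurableSet F →
      F ⊆ hcube x s → volume (hcube x s) ≤ 2 * volume F →
        ν (hcube x s) ≤ ENNReal.ofReal A * ν F) (k : ℕ) :
    ∀ E, MeasurableSet E → E ⊆ hcube c r →
      volume E ≤ ((2 : ℝ≥0∞) ^ (d + 1))⁻¹ ^ k * volume (hcube c r) →
      ν E ≤ ENNReal.ofReal (1 - 1 / A) ^ k * ν (hcube c r) := by
  induction k with
  | zero =>
    intro E _ hE _
    simpa using measure_mono hE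
  | succ k ih =>
    intro E hEm hE hvol
    set t : ℝ≥0∞ := ((2 : ℝ≥0∞) ^ (d + 1))⁻¹ with ht
    have htt : t ≠ ∞ := by simp [ht]
    have ht0 : t ≠ 0 := by simp [ht]
    have ht1 : t < 1 := by
      rw [ht, ENNReal.inv_lt_one]
      exact one_lt_pow₀ (by norm_num) (by omega)
    have hgi : ∀ T : Set Eu, MeasurableSet T →
        ∫⁻ y in T, E.indicator (fun _ => (1 : ℝ≥0∞)) y = volume (E ∩ T) := by
      intro T hT
      rw [lintegral_indicator hEm, setLIntegral_one, Measure.restrict_apply hEm]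
    -- The height t = 2^{-(d+1)} is chosen so that E fills at most 2^d t = 1/2 of each selected
    -- cube, giving one factor 1 - 1/A. Since t < 1, almost all of E lies in their union U. As |U| ≤
    -- |E|/t, the induction hypothesis applies to U.
    obtain ⟨S, hSc, hS, hSd, hSae⟩ := exists_calderonZygmund hd c hr
      (g := E.indicator fun _ => (1 : ℝ≥0∞)) (t := t)
      ((measurable_const.indicator hEm).aemeasurable) htt (by
        rw [hgi _ (measurableSet_hcube c r), inter_eq_self_of_subset_left hE]
        refine hvol.trans ?_
        gcongr
        exact pow_le_of_le_one (by simp) ht1.le (Nat.succ_ne_zero k))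
    set U := ⋃ s ∈ S, hcube s.1 s.2 with hU
    have hUm : MeasurableSet U :=
      MeasurableSet.biUnion hSc fun s _ => measurableSet_hcube _ _
    have hUsub : U ⊆ hcube c r := iUnion₂_subset fun s hs => (hS s hs).2.1
    have hnull : volume (E \ U) = 0 := by
      rw [measure_eq_zero_iff_ae_notMem]
      filter_upwards [hSae] with y hy hyE
      have h1 := hy (hE hyE.1) hyE.2
      rw [indicator_of_mem hyE.1] at h1
      exact absurd ht1 (not_lt.2 h1)
    have hEU : ν E ≤ ν (E ∩ U) := by
      calc ν E ≤ ν (E ∩ U) + ν (E \ U) := measure_le_inter_add_sdiff _ _ _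
        _ = _ := by rw [hν hnull, add_zero]
    have hEUeq : ∀ m : Measure Eu, m (E ∩ U) = ∑' s : S, m (E ∩ hcube s.1.1 s.1.2) := by
      intro m
      rw [hU, inter_iUnion₂, measure_biUnion hSc
        (fun s hs s' hs' h => (hSd hs hs' h).mono inter_subset_right inter_subset_right)
        (fun s _ => hEm.inter (measurableSet_hcube _ _))]
    have hUeq : ∀ m : Measure Eu, m U = ∑' s : S, m (hcube s.1.1 s.1.2) := fun m =>
      measure_biUnion hSc hSd (fun s _ => measurableSet_hcube _ _)
    have hUvol : volume U ≤ t ^ k * volume (hcube c r) := by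
      have h1 : t * volume U ≤ t * (t ^ k * volume (hcube c r)) := by
        calc t * volume U = ∑' s : S, t * volume (hcube s.1.1 s.1.2) := by
              rw [hUeq, ENNReal.tsum_mul_left]
          _ ≤ ∑' s : S, volume (E ∩ hcube s.1.1 s.1.2) := by
              refine ENNReal.tsum_le_tsum fun s => ?_
              rw [← hgi _ (measurableSet_hcube _ _)]
              exact (hS s.1 s.2).2.2.1.le
          _ = volume (E ∩ U) := (hEUeq _).symm
          _ ≤ volume E := measure_mono inter_subset_left
          _ ≤ _ := hvol.trans_eq (by rw [pow_succ']; ring)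
      exact (ENNReal.mul_le_mul_iff_right ht0 htt).1 h1
    calc ν E ≤ ν (E ∩ U) := hEU
      _ = ∑' s : S, ν (E ∩ hcube s.1.1 s.1.2) := hEUeq _
      _ ≤ ∑' s : S, ENNReal.ofReal (1 - 1 / A) * ν (hcube s.1.1 s.1.2) := by
          refine ENNReal.tsum_le_tsum fun s => ?_
          obtain ⟨hs0, hsub, -, hs2⟩ := hS s.1 s.2
          refine measure_le_of_two_mul_le hA (measurableSet_hcube _ _) (volume_hcube_ne_top _ _)
            (ne_top_of_le_ne_top hfin (measure_mono hsub)) (H _ _ hs0 hsub)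
            (hEm.inter (measurableSet_hcube _ _)) inter_subset_right ?_
          rw [hgi _ (measurableSet_hcube _ _)] at hs2
          calc 2 * volume (E ∩ hcube s.1.1 s.1.2) ≤
              2 * (2 ^ d * t * volume (hcube s.1.1 s.1.2)) := by gcongr
            _ = (2 ^ (d + 1) * t) * volume (hcube s.1.1 s.1.2) := by rw [pow_succ]; ring
            _ = _ := by
              rw [ht, ENNReal.mul_inv_cancel (by simp) (by finiteness), one_mul]
      _ = ENNReal.ofReal (1 - 1 / A) * ν U := by rw [ENNReal.tsum_mul_left, hUeq]
      _ ≤ ENNReal.ofReal (1 - 1 / A) * (ENNReal.ofReal (1 - 1 / A) ^ k * ν (hcube c r)) := by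
          gcongr
          exact ih U hUm hUsub hUvol
      _ = _ := by rw [pow_succ']; ring

/-- Power form of `measure_le_pow_mul`. -/
theorem exists_measure_le_rpow_mul (hd : 0 < d) {A : ℝ} (hA : 2 ≤ A) :
    ∃ δ : ℝ, 0 < δ ∧ δ < 1 ∧ ∀ (ν : Measure Eu) (c : Eu) (r : ℝ), ν ≪ volume → 0 < r →
      ν (hcube c r) ≠ ∞ →
      (∀ (x : Eu) (s : ℝ), 0 < s → hcube x s ⊆ hcube c r → ∀ F, MeasurableSet F →
        F ⊆ hcube x s → volume (hcube x s) ≤ 2 * volume F →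
          ν (hcube x s) ≤ ENNReal.ofReal A * ν F) →
      ∀ E, MeasurableSet E → E ⊆ hcube c r →
        ν E ≤ 2 * (volume E / volume (hcube c r)) ^ δ * ν (hcube c r) := by
  set t : ℝ := (2 ^ (d + 1))⁻¹ with ht
  set b : ℝ := 1 - 1 / A with hb
  have hApos : 0 < A := by linarith
  have hA' : 1 / A ≤ 1 / 2 := one_div_le_one_div_of_le (by norm_num) hA
  have hb1 : b < 1 := by rw [hb]; have : 0 < 1 / A := by positivity
                         linarith
  have hb2 : 1 / 2 ≤ b := by rw [hb]; linarith
  have hbpos : 0 < b := by linarith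
  have htpos : 0 < t := by positivity
  have htb : t < b := by
    refine lt_of_lt_of_le ?_ hb2
    rw [ht, one_div]
    exact inv_strictAnti₀ (by norm_num) (lt_self_pow₀ (by norm_num) (by omega))
  have ht1 : t < 1 := htb.trans hb1
  have hδ : t ^ Real.logb t b = b := Real.rpow_logb htpos ht1.ne hbpos
  refine ⟨Real.logb t b, Real.logb_pos_of_base_lt_one htpos ht1 hbpos hb1, ?_, ?_⟩
  · rw [Real.logb_lt_iff_lt_rpow_of_base_lt_one htpos ht1 hbpos, Real.rpow_one]
    exact htb
  have hδpos : 0 < Real.logb t b := Real.logb_pos_of_base_lt_one htpos ht1 hbpos hb1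
  set δ := Real.logb t b
  intro ν c r hν hr hfin H E hEm hE
  rcases eq_or_ne (volume E) 0 with h0 | h0
  · rw [hν h0]; exact zero_le
  have hQ0 := volume_hcube_ne_zero c hr
  have hQt := volume_hcube_ne_top c r
  set u := volume E / volume (hcube c r) with hu
  have hu1 : u ≤ 1 := ENNReal.div_le_of_le_mul (by rw [one_mul]; exact measure_mono hE)
  have hut : u ≠ ∞ := ne_top_of_le_ne_top ENNReal.one_ne_top hu1
  have hu0 : u ≠ 0 := ENNReal.div_ne_zero.2 ⟨h0, hQt⟩
  -- The density u lies between t^{k+1} and t^k. With t^δ = b this gives b^k ≤ u^δ/b, and b ≥ 1/2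
  -- accounts for the constant 2.
  obtain ⟨k, hk1, hk2⟩ := exists_nat_pow_near_of_lt_one (ENNReal.toReal_pos hu0 hut)
    (ENNReal.toReal_mono ENNReal.one_ne_top hu1) htpos ht1
  have htE : ENNReal.ofReal t = ((2 : ℝ≥0∞) ^ (d + 1))⁻¹ := by
    rw [ht, ENNReal.ofReal_inv_of_pos (by positivity), ENNReal.ofReal_pow (by norm_num)]
    simp
  have hle := measure_le_pow_mul hd hν hr hA hfin H k E hEm hE (by
    rw [← htE, ← ENNReal.ofReal_pow htpos.le, mul_comm]
    refine (ENNReal.div_le_iff_le_mul (Or.inl hQ0) (Or.inl hQt)).1 ?_ |>.trans_eq (mul_comm _ _)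
    exact ENNReal.le_ofReal_iff_toReal_le hut (by positivity) |>.2 hk2)
  refine hle.trans ?_
  gcongr
  rw [← ENNReal.ofReal_pow hbpos.le, ← ENNReal.ofReal_toReal hut,
    ENNReal.ofReal_rpow_of_nonneg ENNReal.toReal_nonneg hδpos.le, ← ENNReal.ofReal_ofNat 2,
    ← ENNReal.ofReal_mul (by norm_num)]
  refine ENNReal.ofReal_le_ofReal ?_
  have h3 : b ^ (k + 1) ≤ u.toReal ^ δ := by
    calc b ^ (k + 1) = (t ^ (k + 1)) ^ δ := by
          conv_lhs => rw [← hδ]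
          rw [← Real.rpow_natCast, ← Real.rpow_natCast, ← Real.rpow_mul htpos.le,
            ← Real.rpow_mul htpos.le, mul_comm]
      _ ≤ _ := Real.rpow_le_rpow (by positivity) hk1.le hδpos.le
  have h4 : 0 < b ^ k := by positivity
  rw [pow_succ] at h3
  nlinarith

variable {ρ ω : EuclideanSpace ℝ (Fin d) → ℝ} {p q θ C₀ N₀ : ℝ}

/-- Lower bound for a slowly varying function on a cube. -/
theorem SlowVariation.le_mul_of_mem_cube (hd : 0 < d) (hρ : ∀ x, 0 < ρ x)
    (h : SlowVariation ρ C₀ N₀) {c y : Eu} {r : ℝ} (hr : 0 < r) (hy : y ∈ cube c r) :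
    ρ c ≤ C₀ * d ^ N₀ * (1 + r / ρ c) ^ N₀ * ρ y := by
  obtain ⟨hC, hN, hs⟩ := h
  have hd1 : (1 : ℝ) ≤ d := by exact_mod_cast hd
  have h1 := (hs c y).1
  have hc := hρ c
  have hb : 1 + ‖c - y‖ / ρ c ≤ d * (1 + r / ρ c) := by
    have h2 := norm_sub_le_of_mem_cube hr.le hy
    rw [norm_sub_rev] at h2
    rw [mul_add, mul_one, ← mul_div_assoc]
    gcongr
    nlinarith
  have h3 : (1 + ‖c - y‖ / ρ c) ^ N₀ ≤ d ^ N₀ * (1 + r / ρ c) ^ N₀ := by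
    rw [← Real.mul_rpow (by positivity) (by positivity)]
    exact Real.rpow_le_rpow (by positivity) hb hN.le
  rw [Real.rpow_neg (by positivity), le_div_iff₀ hc] at h1
  have hpos : 0 < (1 + ‖c - y‖ / ρ c) ^ N₀ := by positivity
  have hC' : 0 < C₀ := by linarith
  have h4 : ρ c ≤ C₀ * (1 + ‖c - y‖ / ρ c) ^ N₀ * ρ y := by
    calc ρ c = C₀ * (1 + ‖c - y‖ / ρ c) ^ N₀ *
          (1 / C₀ * ((1 + ‖c - y‖ / ρ c) ^ N₀)⁻¹ * ρ c) := by field_simp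
      _ ≤ _ := by gcongr
  calc ρ c ≤ C₀ * (1 + ‖c - y‖ / ρ c) ^ N₀ * ρ y := h4
    _ ≤ C₀ * (d ^ N₀ * (1 + r / ρ c) ^ N₀) * ρ y := by
        have := hρ y
        gcongr
    _ = _ := by ring

/-- On cubes of side length at most the critical radius, weights in `A_{p,q}` satisfy an `A_∞`
condition with a uniform constant. -/
theorem MemApq.weightPow_le_of_volume_le (hd : 0 < d) (hρ : ∀ x, 0 < ρ x) (hp : 1 ≤ p)
    (hpq : p < q) (hθ : 0 < θ) (h : MemApq ρ θ p q ω) {x : Eu} {s : ℝ} (hs : 0 < s)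
    (hsρ : s ≤ ρ x) {F : Set Eu} (hF : F ⊆ cube x s) (hvol : volume (cube x s) ≤ 2 * volume F) :
    weightPow ω q (cube x s) ≤ ENNReal.ofReal
      ((2 * (cubeFactor d p q θ * (apqConst ρ θ p q ω).toReal * 2 ^ θ)) ^ q) *
        weightPow ω q F := by
  have hq : 0 < q := by linarith
  have hp0 : 0 < p := by linarith
  have hQ0 := volume_cube_ne_zero x hs
  have hQt := volume_cube_ne_top x s
  have h1 := h.setLIntegral_mul_le hd hρ hp hq hθ x hs hF (G := fun _ => 1) aemeasurable_const
  simp only [one_mul, setLIntegral_one] at h1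
  have h2 := h.1.weightPow_rpow_le hp0 hpq.le F
  have hx := hρ x
  have h3 : ENNReal.ofReal ((1 + s / ρ x) ^ θ) ≤ ENNReal.ofReal (2 ^ θ) := by
    refine ENNReal.ofReal_le_ofReal (Real.rpow_le_rpow (by positivity) ?_ hθ.le)
    have : s / ρ x ≤ 1 := (div_le_one hx).2 hsρ
    linarith
  have he : 0 ≤ 1 / p - 1 / q := sub_nonneg.2 (one_div_le_one_div_of_le hp0 hpq.le)
  set T : ℝ := cubeFactor d p q θ * (apqConst ρ θ p q ω).toReal * 2 ^ θ with hT
  have hcf := cubeFactor_pos hd p q θ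
  have hT0 : 0 ≤ T := by positivity
  have hTE : ENNReal.ofReal (cubeFactor d p q θ) * apqConst ρ θ p q ω * ENNReal.ofReal (2 ^ θ) =
      ENNReal.ofReal T := by
    rw [hT, ENNReal.ofReal_mul (by positivity), ENNReal.ofReal_mul (by positivity),
      ENNReal.ofReal_toReal h.2.ne]
  have h4 : volume (cube x s) * weightPow ω q (cube x s) ^ (1 / q) ≤
      volume (cube x s) * (ENNReal.ofReal (2 * T) * weightPow ω q F ^ (1 / q)) := by
    calc _ ≤ 2 * (volume F * weightPow ω q (cube x s) ^ (1 / q)) := by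
          rw [← mul_assoc]; gcongr
      _ ≤ 2 * ((weightPow ω q F ^ (1 / q) * volume (cube x s) ^ (1 / p - 1 / q)) *
            (volume (cube x s) ^ (1 - 1 / p + 1 / q) * ENNReal.ofReal (cubeFactor d p q θ) *
              apqConst ρ θ p q ω * ENNReal.ofReal (2 ^ θ))) := by
          refine mul_le_mul_right (h1.trans (mul_le_mul' (h2.trans ?_) ?_)) _
          · exact mul_le_mul_right (ENNReal.rpow_le_rpow (measure_mono hF) he) _
          · exact mul_le_mul_right h3 _
      _ = (volume (cube x s) ^ (1 / p - 1 / q) * volume (cube x s) ^ (1 - 1 / p + 1 / q)) *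
            (2 * (ENNReal.ofReal (cubeFactor d p q θ) * apqConst ρ θ p q ω *
              ENNReal.ofReal (2 ^ θ)) * weightPow ω q F ^ (1 / q)) := by ring
      _ = _ := by
          rw [← ENNReal.rpow_add _ _ hQ0 hQt, hTE, ENNReal.ofReal_mul (p := 2) (by norm_num)]
          simp
  have h5 := (ENNReal.mul_le_mul_iff_right hQ0 hQt).1 h4
  calc weightPow ω q (cube x s) = (weightPow ω q (cube x s) ^ (1 / q)) ^ q := by
        rw [← ENNReal.rpow_mul, one_div_mul_cancel hq.ne', ENNReal.rpow_one]
    _ ≤ (ENNReal.ofReal (2 * T) * weightPow ω q F ^ (1 / q)) ^ q := by gcongr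
    _ = _ := by
        rw [ENNReal.mul_rpow_of_nonneg _ _ hq.le, ← ENNReal.rpow_mul,
          one_div_mul_cancel hq.ne', ENNReal.rpow_one,
          ENNReal.ofReal_rpow_of_nonneg (by positivity) hq.le]

/-- A weight in `A_{p,q}` satisfies the comparison of `ω^q` with Lebesgue measure. -/
theorem MemApq.exists_weightComparison (hd : 0 < d) (hρ : ∀ x, 0 < ρ x) (hp : 1 ≤ p)
    (hpq : p < q) (hθ : 0 < θ) (hslow : SlowVariation ρ C₀ N₀) (h : MemApq ρ θ p q ω) :
    ∃ δ η K : ℝ, WeightComparison ρ ω q δ η K := by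
  have hq : 0 < q := by linarith
  have hd1 : (1 : ℝ) ≤ d := by exact_mod_cast hd
  obtain ⟨hC, hN, -⟩ := id hslow
  have hC' : 0 < C₀ := by linarith
  set A : ℝ := max 2
    ((2 * (cubeFactor d p q θ * (apqConst ρ θ p q ω).toReal * 2 ^ θ)) ^ q) with hA
  obtain ⟨δ, hδ0, hδ1, hδ⟩ := exists_measure_le_rpow_mul hd (le_max_left 2
    ((2 * (cubeFactor d p q θ * (apqConst ρ θ p q ω).toReal * 2 ^ θ)) ^ q))
  set C₁ : ℝ := 2 * (C₀ * d ^ N₀) with hC₁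
  have hC₁pos : 0 < C₁ := by positivity
  -- The exponent (N₀+1)dδ is the δ-th power of the number of subcritical pieces; the maximum with 2
  -- only secures η > 1.
  refine ⟨δ, max 2 ((N₀ + 1) * (d * δ)), 2 * C₁ ^ (d * δ), hδ0, hδ1,
    lt_max_of_lt_left (by norm_num), by positivity, fun c r hr E hEm hE => ?_⟩
  set ν : Measure Eu := volume.withDensity fun x => ENNReal.ofReal (ω x) ^ q with hνdef
  have hν : ν ≪ volume := withDensity_absolutelyContinuous _ _
  have hνE : ∀ {T : Set Eu}, MeasurableSet T → ν T = weightPow ω q T := fun hT =>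
    withDensity_apply _ hT
  have hc := hρ c
  set L : ℝ := 1 + r / ρ c with hL
  have hL1 : 1 ≤ L := by
    have : 0 < r / ρ c := by positivity
    linarith
  have hLpos : 0 < L := by linarith
  set X : ℝ := C₀ * d ^ N₀ * L ^ (N₀ + 1) with hX
  have hX1 : 1 ≤ X := by
    have h1 : (1 : ℝ) ≤ d ^ N₀ := Real.one_le_rpow hd1 hN.le
    have h2 : 1 ≤ L ^ (N₀ + 1) := Real.one_le_rpow hL1 (by linarith)
    exact one_le_mul_of_one_le_of_one_le (one_le_mul_of_one_le_of_one_le hC h1) h2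
  have hρX : ∀ y ∈ cube c r, r ≤ X * ρ y := by
    intro y hy
    have h1 := hslow.le_mul_of_mem_cube hd hρ hr hy
    have hy := hρ y
    calc r = r / ρ c * ρ c := by field_simp
      _ ≤ L * (C₀ * d ^ N₀ * L ^ N₀ * ρ y) := by
          gcongr
          rw [hL]; linarith
      _ = X * ρ y := by rw [hX, Real.rpow_add hLpos, Real.rpow_one]; ring
  -- Since X < 2^{k+1}, dyadic pieces of level k+1 have side at most ρ(y) for every y in the cube.
  -- Since 2^k ≤ X, the level is not finer than needed.
  obtain ⟨k, hk1, hk2⟩ := exists_nat_pow_near hX1 (one_lt_two (α := ℝ))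
  set D : (Fin d → ℤ) → Set Eu := fun n => dyadicCube c r (k + 1) n with hD
  have hDm : ∀ n, MeasurableSet (D n) := fun n => measurableSet_dyadicCube c hr _ _
  have hDd : Pairwise (Function.onFun Disjoint D) := fun m n hmn => dyadicCube_disjoint hmn
  have hDu : ∀ T : Set Eu, T = ⋃ n, T ∩ D n := by
    intro T
    rw [← inter_iUnion, eq_comm, inter_eq_left]
    intro y _
    exact mem_iUnion.2 ⟨_, mem_dyadicCube_self c r (k + 1) y⟩
  have hsum : ∀ T : Set Eu, MeasurableSet T → ν T = ∑' n, ν (T ∩ D n) := by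
    intro T hT
    conv_lhs => rw [hDu T]
    exact measure_iUnion (fun m n hmn => (hDd hmn).mono inter_subset_right inter_subset_right)
      fun n => hT.inter (hDm n)
  have hQfin : ν (hcube c r) ≠ ∞ := by
    rw [hνE (measurableSet_hcube c r)]
    exact ne_top_of_le_ne_top (h.weightPow_cube_ne_top hd hρ hp hq c hr)
      (lintegral_mono_set (hcube_subset_cube c r))
  set E' := E ∩ hcube c r with hE'
  have hE'm : MeasurableSet E' := hEm.inter (measurableSet_hcube c r)
  have hEE' : ν E = ν E' := by
    have h1 : ν (E \ hcube c r) = 0 := by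
      refine hν (measure_mono_null (sdiff_subset_sdiff_left hE) ?_)
      exact (ae_le_set.1 (hcube_ae_eq_cube c r).symm.le)
    rw [← measure_inter_add_sdiff E (measurableSet_hcube c r), h1, add_zero]
  have hvolD : ∀ n, volume (D n) = ENNReal.ofReal (r / 2 ^ (k + 1)) ^ d := fun n =>
    volume_dyadicCube c hr _ _
  -- Each piece is charged with the whole of |E|. This makes the prefactor independent of n, so
  -- summing over pieces reassembles ν of the cube.
  have hlocal : ∀ n, ν (E' ∩ D n) ≤
      2 * (volume E / ENNReal.ofReal (r / 2 ^ (k + 1)) ^ d) ^ δ * ν (hcube c r ∩ D n) := by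
    intro n
    rcases (hcube c r ∩ D n).eq_empty_or_nonempty with hemp | ⟨y, hyQ, hyD⟩
    · have : E' ∩ D n = ∅ := by
        rw [hE', inter_assoc, hemp, inter_empty]
      rw [this, measure_empty]
      exact zero_le
    · have hsub : D n ⊆ hcube c r := by
        rw [← dyadicCube_zero c hr] at hyQ ⊢
        exact dyadicCube_subset (Nat.zero_le _) hyQ hyD
      have heq : D n = hcube (dyadicCenter c r (k + 1) n) (r / 2 ^ (k + 1)) :=
        dyadicCube_eq_hcube c hr _ _
      rw [inter_eq_self_of_subset_right hsub]
      have h1 := hδ ν (dyadicCenter c r (k + 1) n) (r / 2 ^ (k + 1)) hν (by positivity)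
        (by rw [← heq]; exact ne_top_of_le_ne_top hQfin (measure_mono hsub)) ?_ (E' ∩ D n)
        (hE'm.inter (hDm n)) (by rw [← heq]; exact inter_subset_right)
      · rw [← heq, hvolD] at h1
        refine h1.trans ?_
        gcongr
        exact inter_subset_left.trans inter_subset_left
      · intro x s hs hxs F hFm hF hvol
        have hxQ : x ∈ cube c r := by
          apply hcube_subset_cube
          apply hsub
          rw [heq]
          apply hxs
          intro i
          constructor <;> linarith
        have hs' : s ≤ r / 2 ^ (k + 1) := by
          have h2 := measure_mono (μ := volume) hxs
          rw [volume_hcube, volume_hcube] at h2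
          have h3 := (ENNReal.pow_le_pow_left_iff hd.ne').1 h2
          exact (ENNReal.ofReal_le_ofReal_iff (by positivity)).1 h3
        have hsρ : s ≤ ρ x := by
          refine hs'.trans ?_
          rw [div_le_iff₀ (by positivity), mul_comm]
          exact (hρX x hxQ).trans (by have := hρ x; gcongr)
        rw [hνE hFm, hνE (measurableSet_hcube x s)]
        have h4 : weightPow ω q (hcube x s) = weightPow ω q (cube x s) := by
          unfold weightPow; rw [restrict_hcube]
        rw [h4]
        rw [volume_hcube, ← volume_cube x s] at hvol
        refine (h.weightPow_le_of_volume_le hd hρ hp hpq hθ hs hsρ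
          (hF.trans (hcube_subset_cube x s)) hvol).trans ?_
        gcongr
        exact le_max_right _ _
  have htot : ν E ≤ 2 * (volume E / ENNReal.ofReal (r / 2 ^ (k + 1)) ^ d) ^ δ * ν (hcube c r) := by
    rw [hEE', hsum E' hE'm, hsum (hcube c r) (measurableSet_hcube c r), ← ENNReal.tsum_mul_left]
    exact ENNReal.tsum_le_tsum hlocal
  have hνQ : ν (hcube c r) = weightPow ω q (cube c r) := by
    rw [hνE (measurableSet_hcube c r)]
    unfold weightPow; rw [restrict_hcube]
  rw [hνQ, hνE hEm] at htot
  refine ENNReal.div_le_of_le_mul (htot.trans (mul_le_mul_left ?_ _))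
  have hscale : volume E / ENNReal.ofReal (r / 2 ^ (k + 1)) ^ d =
      volume E / volume (cube c r) * ENNReal.ofReal ((2 ^ (k + 1)) ^ d) := by
    have hb : ENNReal.ofReal r ^ d =
        ENNReal.ofReal (r / 2 ^ (k + 1)) ^ d * ENNReal.ofReal ((2 ^ (k + 1)) ^ d) := by
      rw [ENNReal.ofReal_pow (by positivity), ← mul_pow, ← ENNReal.ofReal_mul (by positivity),
        div_mul_cancel₀ _ (by positivity)]
    rw [volume_cube, hb, ← ENNReal.mul_div_right_comm, ENNReal.mul_div_mul_right _ _
      (ENNReal.ofReal_pos.2 (by positivity)).ne' ENNReal.ofReal_ne_top]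
  rw [hscale, ENNReal.mul_rpow_of_nonneg _ _ hδ0.le, ENNReal.ofReal_mul (by norm_num),
    ENNReal.ofReal_ofNat]
  have hfinal : ENNReal.ofReal ((2 ^ (k + 1)) ^ d) ^ δ ≤
      ENNReal.ofReal (C₁ ^ (d * δ)) * ENNReal.ofReal (L ^ max 2 ((N₀ + 1) * (d * δ))) := by
    rw [ENNReal.ofReal_rpow_of_nonneg (by positivity) hδ0.le,
      ← ENNReal.ofReal_mul (by positivity)]
    refine ENNReal.ofReal_le_ofReal ?_
    have h2k : (2 : ℝ) ^ (k + 1) ≤ C₁ * L ^ (N₀ + 1) := by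
      rw [pow_succ, hC₁]
      rw [hX] at hk1
      linarith
    calc (((2 : ℝ) ^ (k + 1)) ^ d) ^ δ = (2 ^ (k + 1)) ^ (d * δ) := by
          rw [← Real.rpow_natCast (2 ^ (k + 1)) d, ← Real.rpow_mul (by positivity)]
      _ ≤ (C₁ * L ^ (N₀ + 1)) ^ (d * δ) := by gcongr
      _ = C₁ ^ (d * δ) * L ^ ((N₀ + 1) * (d * δ)) := by
          rw [Real.mul_rpow (by positivity) (by positivity), ← Real.rpow_mul hLpos.le]
      _ ≤ _ := by
          gcongr
          exact le_max_right _ _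
  calc 2 * ((volume E / volume (cube c r)) ^ δ * ENNReal.ofReal ((2 ^ (k + 1)) ^ d) ^ δ) ≤
      2 * ((volume E / volume (cube c r)) ^ δ * (ENNReal.ofReal (C₁ ^ (d * δ)) *
        ENNReal.ofReal (L ^ max 2 ((N₀ + 1) * (d * δ))))) := by gcongr
    _ = _ := by ring

end Comparison

/-! ### The lower oscillation, and the converse bound. -/

section LowerOscillation

open Set Filter Topology Metric

variable {d : ℕ}

local notation "Eu" => EuclideanSpace ℝ (Fin d)

theorem ofReal_rpow_mul_ofReal_rpow {x : ℝ} (hx : 0 < x) (a b : ℝ) :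
    ENNReal.ofReal (x ^ a) * ENNReal.ofReal (x ^ b) = ENNReal.ofReal (x ^ (a + b)) := by
  rw [← ENNReal.ofReal_mul (by positivity), ← Real.rpow_add hx]

theorem lowerOsc_eq_ofReal {f : Eu → ℝ} {S : Set Eu} {m : ℝ}
    (hm : essInf (fun y => (f y : EReal)) (volume.restrict S) = m) (x : Eu) :
    lowerOsc f S x = ENNReal.ofReal (f x - m) := by
  rw [lowerOsc, hm, ← EReal.coe_sub, EReal.toENNReal_of_ne_top (EReal.coe_ne_top _),
    EReal.toReal_coe]

theorem lowerOsc_eq_top {f : Eu → ℝ} {S : Set Eu}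
    (hm : essInf (fun y => (f y : EReal)) (volume.restrict S) = ⊥) (x : Eu) :
    lowerOsc f S x = ∞ := by
  rw [lowerOsc, hm, EReal.sub_bot (EReal.coe_ne_bot _), EReal.toENNReal_top]

theorem aemeasurable_lowerOsc {f : Eu → ℝ} (hf : AEMeasurable f volume) (S : Set Eu) :
    AEMeasurable (lowerOsc f S) volume := by
  rcases h : essInf (fun y => (f y : EReal)) (volume.restrict S) with _ | _ | m
  · have : lowerOsc f S = fun _ => ∞ := funext fun x => lowerOsc_eq_top h x
    rw [this]; exact aemeasurable_const
  · have : lowerOsc f S = fun _ => 0 := funext fun x => by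
      rw [lowerOsc, h]
      refine EReal.toENNReal_of_nonpos ?_
      change (f x : EReal) - ⊤ ≤ 0
      rw [EReal.sub_top]
      exact bot_le
    rw [this]; exact aemeasurable_const
  · have : lowerOsc f S = fun x => ENNReal.ofReal (f x - m) :=
      funext fun x => lowerOsc_eq_ofReal h x
    rw [this]
    exact (hf.sub_const m).ennreal_ofReal

/-- If the lower oscillation has finite integral then the essential infimum is a real number. -/
theorem exists_essInf_eq_coe {f : Eu → ℝ} {S : Set Eu} (hS : volume S ≠ 0)
    (h : ∫⁻ x in S, lowerOsc f S x ≠ ∞) :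
    ∃ m : ℝ, essInf (fun y => (f y : EReal)) (volume.restrict S) = m ∧
      ∀ᵐ x ∂volume.restrict S, m ≤ f x := by
  have hae := ae_essInf_le (μ := volume.restrict S) (f := fun y => (f y : EReal))
  rcases hm : essInf (fun y => (f y : EReal)) (volume.restrict S) with _ | _ | m
  · exfalso
    apply h
    simp only [lowerOsc_eq_top hm, lintegral_const, Measure.restrict_apply_univ]
    exact ENNReal.top_mul hS
  · exfalso
    have h2 : ∀ᵐ y ∂volume.restrict S, False := by
      filter_upwards [hae] with y hy
      rw [hm] at hy
      exact EReal.coe_ne_top _ (top_le_iff.1 hy)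
    simp only [eventually_false_iff_eq_bot, ae_eq_bot, Measure.restrict_eq_zero] at h2
    exact hS h2
  · refine ⟨m, rfl, ?_⟩
    filter_upwards [hae] with y hy
    rw [hm] at hy
    exact EReal.coe_le_coe_iff.1 hy

variable {ρ ω f : EuclideanSpace ℝ (Fin d) → ℝ} {p q θ : ℝ}

theorem lintegral_lowerOsc_le (hρ : ∀ x, 0 < ρ x) (f : Eu → ℝ) (θ : ℝ) (c : Eu) {r : ℝ}
    (hr : 0 < r) : ∫⁻ x in cube c r, lowerOsc f (cube c r) x ≤
      bloConst ρ θ f * ENNReal.ofReal ((1 + r / ρ c) ^ θ) * volume (cube c r) := by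
  have h : ENNReal.ofReal ((1 + r / ρ c) ^ (-θ)) *
      ⨍⁻ x in cube c r, lowerOsc f (cube c r) x ∂volume ≤ bloConst ρ θ f :=
    le_iSup_of_le c (le_iSup_of_le r (le_iSup_of_le hr le_rfl))
  have hpos : 0 < 1 + r / ρ c := by have := hρ c; positivity
  calc _ = (ENNReal.ofReal ((1 + r / ρ c) ^ (-θ)) * ENNReal.ofReal ((1 + r / ρ c) ^ θ)) *
        (volume (cube c r) * ⨍⁻ x in cube c r, lowerOsc f (cube c r) x ∂volume) := by
        rw [ofReal_rpow_mul_ofReal_rpow hpos, setLAverage_eq,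
          ENNReal.mul_div_cancel (volume_cube_ne_zero c hr) (volume_cube_ne_top c r)]
        simp
    _ = (ENNReal.ofReal ((1 + r / ρ c) ^ (-θ)) *
        ⨍⁻ x in cube c r, lowerOsc f (cube c r) x ∂volume) *
          ENNReal.ofReal ((1 + r / ρ c) ^ θ) * volume (cube c r) := by ring
    _ ≤ _ := by gcongr

/-- The mean lower oscillation is controlled by the weighted one. -/
theorem MemApq.lintegral_lowerOsc_le (hd : 0 < d) (hρ : ∀ x, 0 < ρ x) (hp : 1 ≤ p)
    (hpq : p < q) (hθ : 0 < θ) (h : MemApq ρ θ p q ω) (hf : AEMeasurable f volume) (c : Eu)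
    {r : ℝ} (hr : 0 < r) :
    ∫⁻ x in cube c r, lowerOsc f (cube c r) x ≤ weightedOsc p q ω f (cube c r) *
      (ENNReal.ofReal (cubeFactor d p q θ) * apqConst ρ θ p q ω *
        ENNReal.ofReal ((1 + r / ρ c) ^ θ)) * volume (cube c r) := by
  have hq : 0 < q := by linarith
  have hp0 : 0 < p := by linarith
  set Q := cube c r with hQ
  set G := lowerOsc f Q with hG
  have hGm : AEMeasurable G (volume.restrict Q) := (aemeasurable_lowerOsc hf Q).restrict
  have hQ0 : volume Q ≠ 0 := volume_cube_ne_zero c hr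
  have hQt : volume Q ≠ ∞ := volume_cube_ne_top c r
  have hWt : weightPow ω q Q ≠ ∞ := h.weightPow_cube_ne_top hd hρ hp hq c hr
  have hW0 : weightPow ω q Q ≠ 0 := h.weightPow_ne_zero hρ hp hq hq hQ0
  have hV0 : weightPow ω p Q ≠ 0 := h.weightPow_ne_zero hρ hp hq hp0 hQ0
  have he : 0 ≤ 1 / p - 1 / q := sub_nonneg.2 (one_div_le_one_div_of_le hp0 hpq.le)
  have hVW := h.1.weightPow_rpow_le hp0 hpq.le Q
  have hV0' : weightPow ω p Q ^ (1 / p) ≠ 0 := by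
    rw [ne_eq, ENNReal.rpow_eq_zero_iff_of_pos (by positivity)]; exact hV0
  have hWt' : weightPow ω q Q ^ (1 / q) ≠ ∞ := ENNReal.rpow_ne_top_of_nonneg (by positivity) hWt
  have hW0' : weightPow ω q Q ^ (1 / q) ≠ 0 := by
    rw [ne_eq, ENNReal.rpow_eq_zero_iff_of_pos (by positivity)]; exact hW0
  have hVt' : weightPow ω p Q ^ (1 / p) ≠ ∞ := ne_top_of_le_ne_top
    (ENNReal.mul_ne_top hWt' (ENNReal.rpow_ne_top_of_nonneg he hQt)) hVW
  have h1 := h.setLIntegral_mul_le hd hρ hp hq hθ c hr (subset_refl Q) hGm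
  -- Raises the exponent from p to q, producing the integral in `weightedOsc`.
  have h2 := lintegral_rpow_le_mul_measure_univ (hGm.mul h.1.aemeasurable.restrict) hp0 hpq.le
  rw [Measure.restrict_apply_univ] at h2
  have h3 : (∫⁻ x in Q, (G x * ENNReal.ofReal (ω x)) ^ q) ^ (1 / q) * volume Q ^ (1 / p - 1 / q) =
      weightedOsc p q ω f Q * weightPow ω p Q ^ (1 / p) := by
    rw [weightedOsc, mul_right_comm, ENNReal.div_mul_cancel hV0' hVt', mul_comm]
    congr 2
    refine lintegral_congr fun x => ?_
    rw [ENNReal.mul_rpow_of_nonneg _ _ hq.le]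
  set Y := ENNReal.ofReal (cubeFactor d p q θ) * apqConst ρ θ p q ω *
        ENNReal.ofReal ((1 + r / ρ c) ^ θ) with hY
  -- Bounding ω^p(Q)^{1/p} by ω^q(Q)^{1/q}|Q|^{1/p-1/q} puts the same factor ω^q(Q)^{1/q} on both
  -- sides. It is positive and finite, hence cancels.
  have h4 : weightPow ω q Q ^ (1 / q) * ∫⁻ x in Q, G x ≤
      weightPow ω q Q ^ (1 / q) * (weightedOsc p q ω f Q * Y * volume Q) := by
    calc _ = (∫⁻ x in Q, G x) * weightPow ω q Q ^ (1 / q) := mul_comm _ _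
      _ ≤ (weightedOsc p q ω f Q * (weightPow ω q Q ^ (1 / q) * volume Q ^ (1 / p - 1 / q))) *
          (volume Q ^ (1 - 1 / p + 1 / q) * ENNReal.ofReal (cubeFactor d p q θ) *
          apqConst ρ θ p q ω * ENNReal.ofReal ((1 + r / ρ c) ^ θ)) := by
          refine h1.trans (mul_le_mul_left (h2.trans (h3.le.trans ?_)) _)
          exact mul_le_mul_right hVW _
      _ = weightPow ω q Q ^ (1 / q) * (weightedOsc p q ω f Q * Y *
            (volume Q ^ (1 / p - 1 / q) * volume Q ^ (1 - 1 / p + 1 / q))) := by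
          rw [hY]; ring
      _ = _ := by
          rw [← ENNReal.rpow_add _ _ hQ0 hQt]
          simp
  exact (ENNReal.mul_le_mul_iff_right hW0' hWt').1 h4

/-- A finite integral forces a real essential infimum m, and f = (f - m) + m. This supplies the
local integrability that the converse has to prove. -/
theorem integrableOn_of_lintegral_lowerOsc_ne_top (hf : AEMeasurable f volume) {S : Set Eu}
    (hS : volume S ≠ 0) (hSt : volume S ≠ ∞) (h : ∫⁻ x in S, lowerOsc f S x ≠ ∞) :
    IntegrableOn f S := by
  obtain ⟨m, hm, hae⟩ := exists_essInf_eq_coe hS h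
  simp only [lowerOsc_eq_ofReal hm] at h
  have h1 : IntegrableOn (fun x => f x - m) S := by
    refine ⟨(hf.sub_const m).aestronglyMeasurable.restrict, ?_⟩
    rw [hasFiniteIntegral_iff_ofReal]
    · exact h.lt_top
    · filter_upwards [hae] with x hx
      simpa using hx
  have h2 : IntegrableOn (fun _ : Eu => m) S := integrableOn_const hSt
  exact (h1.add h2).congr_fun_ae (Eventually.of_forall fun x => sub_add_cancel (f x) m)

/-- A weighted lower oscillation bound implies membership in `BLO`. -/
theorem MemApq.memBLO_of_weightedOsc_le (hd : 0 < d) (hρ : ∀ x, 0 < ρ x) (hp : 1 ≤ p)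
    (hpq : p < q) {θ₁ : ℝ} (hθ : 0 < θ) (h : MemApq ρ θ p q ω) (hf : AEMeasurable f volume)
    {C M : ℝ} (hC : 0 < C) (hM : apqConst ρ θ p q ω ≤ ENNReal.ofReal M)
    (hosc : ∀ (x₀ : Eu) (r : ℝ), 0 < r → weightedOsc p q ω f (cube x₀ r) ≤
      ENNReal.ofReal C * apqConst ρ θ p q ω * ENNReal.ofReal ((1 + r / ρ x₀) ^ (θ₁ - θ))) :
    MemBLO ρ θ₁ f ∧ bloConst ρ θ₁ f ≤
      ENNReal.ofReal (C * cubeFactor d p q θ * max M 1) * apqConst ρ θ p q ω := by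
  have hcf := cubeFactor_pos hd p q θ
  have key : ∀ (c : Eu) (r : ℝ), 0 < r → ∫⁻ x in cube c r, lowerOsc f (cube c r) x ≤
      ENNReal.ofReal (C * cubeFactor d p q θ * max M 1) * apqConst ρ θ p q ω *
        ENNReal.ofReal ((1 + r / ρ c) ^ θ₁) * volume (cube c r) := by
    intro c r hr
    refine (h.lintegral_lowerOsc_le hd hρ hp hpq hθ hf c hr).trans (mul_le_mul_left ?_ _)
    have hpos : 0 < 1 + r / ρ c := by have := hρ c; positivity
    calc _ ≤ (ENNReal.ofReal C * apqConst ρ θ p q ω *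
          ENNReal.ofReal ((1 + r / ρ c) ^ (θ₁ - θ))) * (ENNReal.ofReal (cubeFactor d p q θ) *
          apqConst ρ θ p q ω * ENNReal.ofReal ((1 + r / ρ c) ^ θ)) :=
          mul_le_mul_left (hosc c r hr) _
      _ = (ENNReal.ofReal C * ENNReal.ofReal (cubeFactor d p q θ) * apqConst ρ θ p q ω) *
          apqConst ρ θ p q ω * (ENNReal.ofReal ((1 + r / ρ c) ^ (θ₁ - θ)) *
            ENNReal.ofReal ((1 + r / ρ c) ^ θ)) := by ring
      _ = (ENNReal.ofReal C * ENNReal.ofReal (cubeFactor d p q θ) * apqConst ρ θ p q ω) *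
          apqConst ρ θ p q ω * ENNReal.ofReal ((1 + r / ρ c) ^ θ₁) := by
          rw [ofReal_rpow_mul_ofReal_rpow hpos, sub_add_cancel]
      -- The hypothesis and the A_{p,q} condition contribute one factor [ω] each; one is absorbed
      -- into the bound M. The maximum with 1 keeps the constant positive.
      _ ≤ (ENNReal.ofReal C * ENNReal.ofReal (cubeFactor d p q θ) * ENNReal.ofReal (max M 1)) *
          apqConst ρ θ p q ω * ENNReal.ofReal ((1 + r / ρ c) ^ θ₁) := by
          gcongr
          exact hM.trans (ENNReal.ofReal_le_ofReal (le_max_left _ _))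
      _ = _ := by
          rw [← ENNReal.ofReal_mul hC.le, ← ENNReal.ofReal_mul (by positivity)]
  have hblo : bloConst ρ θ₁ f ≤
      ENNReal.ofReal (C * cubeFactor d p q θ * max M 1) * apqConst ρ θ p q ω := by
    refine iSup_le fun c => iSup_le fun r => iSup_le fun hr => ?_
    have hpos : 0 < 1 + r / ρ c := by have := hρ c; positivity
    have h2 : ⨍⁻ x in cube c r, lowerOsc f (cube c r) x ∂volume ≤
        ENNReal.ofReal (C * cubeFactor d p q θ * max M 1) * apqConst ρ θ p q ω *
        ENNReal.ofReal ((1 + r / ρ c) ^ θ₁) := by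
      rw [setLAverage_eq]
      exact ENNReal.div_le_of_le_mul (key c r hr)
    refine (mul_le_mul_right h2 _).trans (le_of_eq ?_)
    rw [mul_comm, mul_assoc, ofReal_rpow_mul_ofReal_rpow hpos]
    simp
  refine ⟨⟨fun x => ?_, hblo.trans_lt
    (ENNReal.mul_lt_top ENNReal.ofReal_lt_top h.2)⟩, hblo⟩
  refine ⟨cube x (2 * 1), Filter.mem_of_superset (closedBall_mem_nhds x one_pos)
    (closedBall_subset_cube x 1), ?_⟩
  refine integrableOn_of_lintegral_lowerOsc_ne_top hf (volume_cube_ne_zero x (by norm_num))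
    (volume_cube_ne_top x _) (ne_top_of_le_ne_top ?_ (key x (2 * 1) (by norm_num)))
  exact ENNReal.mul_ne_top (ENNReal.mul_ne_top (ENNReal.mul_ne_top ENNReal.ofReal_ne_top h.2.ne)
    ENNReal.ofReal_ne_top) (volume_cube_ne_top x _)

end LowerOscillation

/-! ### John–Nirenberg decay and the forward bound. -/

section JohnNirenberg

open Set Filter Topology Metric

variable {d : ℕ}

local notation "Eu" => EuclideanSpace ℝ (Fin d)

/-- John–Nirenberg inequality for functions of bounded lower oscillation on the subcubes of a
cube; `m x s` is any lower bound of `f` on the cube `hcube x s`. -/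
theorem volume_lowerOsc_gt_le (hd : 0 < d) {f : Eu → ℝ} (hf : AEMeasurable f volume) {L : ℝ}
    (hL : 0 < L) {c : Eu} {r : ℝ} {m : Eu → ℝ → ℝ}
    (H : ∀ (x : Eu) (s : ℝ), 0 < s → hcube x s ⊆ hcube c r →
      (∀ᵐ y ∂volume.restrict (hcube x s), m x s ≤ f y) ∧
        ∫⁻ y in hcube x s, ENNReal.ofReal (f y - m x s) ≤
          ENNReal.ofReal L * volume (hcube x s)) (k : ℕ) :
    ∀ (x : Eu) (s : ℝ), 0 < s → hcube x s ⊆ hcube c r →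
      volume {y | y ∈ hcube x s ∧ m x s + k * (2 ^ (d + 1) * L) < f y} ≤
        (2 : ℝ≥0∞)⁻¹ ^ k * volume (hcube x s) := by
  induction k with
  | zero =>
    intro x s _ _
    rw [pow_zero, one_mul]
    exact measure_mono fun y hy => hy.1
  | succ k ih =>
    intro x s hs hsub
    obtain ⟨-, hmean⟩ := H x s hs hsub
    set t : ℝ≥0∞ := ENNReal.ofReal (2 * L) with ht
    have htL : t = 2 * ENNReal.ofReal L := by rw [ht, ENNReal.ofReal_mul (by norm_num)]; simp
    have hgm : AEMeasurable (fun y => ENNReal.ofReal (f y - m x s)) volume :=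
      (hf.sub_const _).ennreal_ofReal
    -- Height 2L is twice the bound for the mean, so the selected cubes fill at most half of the
    -- cube.
    obtain ⟨S, hSc, hS, hSd, hSae⟩ := exists_calderonZygmund hd x hs
      (g := fun y => ENNReal.ofReal (f y - m x s)) (t := t) hgm.restrict ENNReal.ofReal_ne_top
      (hmean.trans (mul_le_mul_left (ENNReal.ofReal_le_ofReal (by linarith)) _))
    set U := ⋃ z ∈ S, hcube z.1 z.2 with hU
    have hUsub : U ⊆ hcube x s := iUnion₂_subset fun z hz => (hS z hz).2.1
    have hUsum : volume U = ∑' z : S, volume (hcube z.1.1 z.1.2) :=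
      measure_biUnion hSc hSd fun z _ => measurableSet_hcube _ _
    have hL0 : ENNReal.ofReal L ≠ 0 := (ENNReal.ofReal_pos.2 hL).ne'
    have hUvol : volume U ≤ 2⁻¹ * volume (hcube x s) := by
      have h1 : t * volume U ≤ ENNReal.ofReal L * volume (hcube x s) := by
        calc t * volume U = ∑' z : S, t * volume (hcube z.1.1 z.1.2) := by
              rw [hUsum, ENNReal.tsum_mul_left]
          _ ≤ ∑' z : S, ∫⁻ y in hcube z.1.1 z.1.2, ENNReal.ofReal (f y - m x s) :=
              ENNReal.tsum_le_tsum fun z => (hS z.1 z.2).2.2.1.le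
          _ = ∫⁻ y in U, ENNReal.ofReal (f y - m x s) :=
              (lintegral_biUnion hSc (fun z _ => measurableSet_hcube _ _) hSd _).symm
          _ ≤ ∫⁻ y in hcube x s, ENNReal.ofReal (f y - m x s) := lintegral_mono_set hUsub
          _ ≤ _ := hmean
      have h2 : ENNReal.ofReal L * (2 * volume U) ≤ ENNReal.ofReal L * volume (hcube x s) := by
        rw [← mul_assoc, mul_comm (ENNReal.ofReal L) 2, ← htL]; exact h1
      have h3 := (ENNReal.mul_le_mul_iff_right hL0 ENNReal.ofReal_ne_top).1 h2
      rw [mul_comm, ← div_eq_mul_inv, ENNReal.le_div_iff_mul_le (by simp) (by simp), mul_comm]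
      exact h3
    -- A lower bound of f on a selected cube cannot exceed the mean of f there, which is at most m x
    -- s + 2^d · 2L. Hence the step size 2^{d+1}L.
    have hmz : ∀ z ∈ S, m z.1 z.2 ≤ m x s + 2 ^ (d + 1) * L := by
      intro z hz
      obtain ⟨hz0, hzsub, -, hz2⟩ := hS z hz
      obtain ⟨hlow, -⟩ := H z.1 z.2 hz0 (hzsub.trans hsub)
      have h1 : ENNReal.ofReal (m z.1 z.2 - m x s) * volume (hcube z.1 z.2) ≤
          ENNReal.ofReal (2 ^ (d + 1) * L) * volume (hcube z.1 z.2) := by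
        calc _ = ∫⁻ _ in hcube z.1 z.2, ENNReal.ofReal (m z.1 z.2 - m x s) := by
              rw [setLIntegral_const]
          _ ≤ ∫⁻ y in hcube z.1 z.2, ENNReal.ofReal (f y - m x s) := by
              refine lintegral_mono_ae ?_
              filter_upwards [hlow] with y hy
              gcongr
          _ ≤ _ := hz2
          _ = _ := by
              congr 1
              rw [ht, pow_succ, mul_assoc, ENNReal.ofReal_mul (p := 2 ^ d) (by positivity),
                ENNReal.ofReal_pow (by norm_num), ENNReal.ofReal_ofNat]
      have h2 := (ENNReal.mul_le_mul_iff_left (volume_hcube_ne_zero _ hz0)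
        (volume_hcube_ne_top _ _)).1 h1
      have h3 := (ENNReal.ofReal_le_ofReal_iff (by positivity)).1 h2
      linarith
    -- Outside U, f is at most m x s + 2L. Inside, the base value rises by at most one step, so
    -- level k+1 of the cube lies in level k of the selected cubes.
    have hcover : ({y | y ∈ hcube x s ∧ m x s + ((k + 1 : ℕ) : ℝ) * (2 ^ (d + 1) * L) < f y} :
        Set Eu) ≤ᵐ[volume] (⋃ z ∈ S,
          {y | y ∈ hcube z.1 z.2 ∧ m z.1 z.2 + k * (2 ^ (d + 1) * L) < f y} : Set Eu) := by
      filter_upwards [hSae] with y hy hyT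
      obtain ⟨hyx, hyf⟩ := hyT
      push_cast at hyf
      have hΛ : 2 * L ≤ 2 ^ (d + 1) * L := by
        gcongr
        exact le_self_pow₀ (by norm_num) (Nat.succ_ne_zero d)
      have hkΛ : 0 ≤ (k : ℝ) * (2 ^ (d + 1) * L) := by positivity
      by_cases hyU : y ∈ U
      · obtain ⟨z, hz, hyz⟩ := mem_iUnion₂.1 hyU
        refine mem_iUnion₂.2 ⟨z, hz, hyz, ?_⟩
        have := hmz z hz
        linarith
      · have h1 := (ENNReal.ofReal_le_ofReal_iff (by positivity)).1 (hy hyx hyU)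
        linarith
    calc _ ≤ volume (⋃ z ∈ S,
          {y | y ∈ hcube z.1 z.2 ∧ m z.1 z.2 + k * (2 ^ (d + 1) * L) < f y}) :=
          measure_mono_ae hcover
      _ ≤ ∑' z : S, volume {y | y ∈ hcube z.1.1 z.1.2 ∧
            m z.1.1 z.1.2 + k * (2 ^ (d + 1) * L) < f y} := measure_biUnion_le _ hSc _
      _ ≤ ∑' z : S, (2 : ℝ≥0∞)⁻¹ ^ k * volume (hcube z.1.1 z.1.2) :=
          ENNReal.tsum_le_tsum fun z =>
            ih _ _ (hS z.1 z.2).1 ((hS z.1 z.2).2.1.trans hsub)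
      _ = (2 : ℝ≥0∞)⁻¹ ^ k * volume U := by rw [ENNReal.tsum_mul_left, hUsum]
      _ ≤ (2 : ℝ≥0∞)⁻¹ ^ k * (2⁻¹ * volume (hcube x s)) := by gcongr
      _ = _ := by rw [pow_succ, mul_assoc]

theorem summable_rpow_mul_geometric {q x : ℝ} (hx0 : 0 < x) (hx1 : x < 1) :
    Summable fun k : ℕ => ((k : ℝ) + 1) ^ q * x ^ k := by
  have h1 := summable_pow_mul_geometric_of_norm_lt_one ⌈q⌉₊
    (r := x) (by rwa [Real.norm_of_nonneg hx0.le])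
  have h2 := ((summable_nat_add_iff 1).2 h1).mul_left x⁻¹
  refine Summable.of_nonneg_of_le (fun k => by positivity) (fun k => ?_) h2
  calc ((k : ℝ) + 1) ^ q * x ^ k ≤ ((k : ℝ) + 1) ^ (⌈q⌉₊ : ℝ) * x ^ k := by
        gcongr
        · linarith [k.cast_nonneg (α := ℝ)]
        · exact Nat.le_ceil q
    _ = _ := by
        rw [Real.rpow_natCast, pow_succ x k]
        push_cast
        field_simp

/-- Exponential decay of the level sets gives a bound of the weighted `L^q` norm. -/
theorem lintegral_rpow_le_of_level_sets {w : Eu → ℝ≥0∞} (hw : AEMeasurable w volume) {g : Eu → ℝ}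
    {Q : Set Eu} (hQ : MeasurableSet Q) {F : ℕ → Set Eu} (hFm : ∀ k, MeasurableSet (F k))
    {Λ q x : ℝ} (hΛ : 0 < Λ) (hq : 0 < q) (hx0 : 0 < x) (hx1 : x < 1) {Y : ℝ≥0∞}
    (hF : ∀ k : ℕ, ∀ y ∈ Q, k * Λ < g y → y ∈ F k)
    (hwF : ∀ k, ∫⁻ y in F k, w y ≤ ENNReal.ofReal (x ^ k) * Y) :
    ∫⁻ y in Q, ENNReal.ofReal (g y) ^ q * w y ≤
      ENNReal.ofReal (Λ ^ q * ∑' k : ℕ, ((k : ℝ) + 1) ^ q * x ^ k) * Y := by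
  have hpt : ∀ y ∈ Q, ENNReal.ofReal (g y) ^ q * w y ≤
      ∑' k : ℕ, ENNReal.ofReal (Λ ^ q * ((k : ℝ) + 1) ^ q) * (F k).indicator w y := by
    intro y hy
    rcases le_or_gt (g y) 0 with h0 | h0
    · rw [ENNReal.ofReal_of_nonpos h0, ENNReal.zero_rpow_of_pos hq, zero_mul]
      exact zero_le
    -- The n-th term alone dominates on the slab nΛ < g ≤ (n+1)Λ. Taking a ceiling minus one gives
    -- the strict inequality on the left.
    · obtain ⟨n, hn1, hn2⟩ : ∃ n : ℕ, n * Λ < g y ∧ g y ≤ (n + 1) * Λ := by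
        have hpos : 0 < g y / Λ := by positivity
        have hc1 : 1 ≤ ⌈g y / Λ⌉₊ := Nat.one_le_iff_ne_zero.2 (Nat.ceil_pos.2 hpos).ne'
        refine ⟨⌈g y / Λ⌉₊ - 1, ?_, ?_⟩
        · have := Nat.ceil_lt_add_one hpos.le
          rw [← lt_div_iff₀ hΛ, Nat.cast_sub hc1]
          push_cast
          linarith
        · have := Nat.le_ceil (g y / Λ)
          rw [← div_le_iff₀ hΛ, Nat.cast_sub hc1]
          push_cast
          linarith
      refine le_trans ?_ (ENNReal.le_tsum n)
      rw [indicator_of_mem (hF n y hy hn1)]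
      gcongr
      rw [ENNReal.ofReal_rpow_of_nonneg h0.le hq.le, ← Real.mul_rpow hΛ.le (by positivity)]
      refine ENNReal.ofReal_le_ofReal (Real.rpow_le_rpow h0.le ?_ hq.le)
      linarith
  calc _ ≤ ∫⁻ y in Q, ∑' k : ℕ, ENNReal.ofReal (Λ ^ q * ((k : ℝ) + 1) ^ q) *
        (F k).indicator w y := by
        refine lintegral_mono_ae ?_
        exact (ae_restrict_iff' hQ).2 (Eventually.of_forall hpt)
    _ ≤ ∫⁻ y, ∑' k : ℕ, ENNReal.ofReal (Λ ^ q * ((k : ℝ) + 1) ^ q) * (F k).indicator w y :=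
        setLIntegral_le_lintegral _ _
    _ = ∑' k : ℕ, ENNReal.ofReal (Λ ^ q * ((k : ℝ) + 1) ^ q) * ∫⁻ y in F k, w y := by
        rw [lintegral_tsum fun k => ((hw.indicator (hFm k)).const_mul _)]
        refine tsum_congr fun k => ?_
        rw [lintegral_const_mul'' _ (hw.indicator (hFm k)), lintegral_indicator (hFm k)]
    _ ≤ ∑' k : ℕ, ENNReal.ofReal (Λ ^ q * (((k : ℝ) + 1) ^ q * x ^ k)) * Y := by
        refine ENNReal.tsum_le_tsum fun k => ?_
        refine (mul_le_mul_right (hwF k) _).trans (le_of_eq ?_)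
        rw [← mul_assoc, ← ENNReal.ofReal_mul (by positivity), mul_assoc]
    _ = _ := by
        rw [ENNReal.tsum_mul_right, ← ENNReal.ofReal_tsum_of_nonneg (fun k => by positivity)
          ((summable_rpow_mul_geometric hx0 hx1).mul_left _), tsum_mul_left]

variable {ρ ω f : EuclideanSpace ℝ (Fin d) → ℝ} {p q θ C₀ N₀ δ η K : ℝ}

/-- Origin of the exponent (N₀+1)θ₁: ρ may drop by the factor (1 + r/ρ(c))^{N₀} inside the cube, and
r/ρ(c) contributes one more power. -/
theorem SlowVariation.one_add_div_le (hd : 0 < d) (hρ : ∀ x, 0 < ρ x)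
    (h : SlowVariation ρ C₀ N₀) {c x : Eu} {r s : ℝ} (hr : 0 < r) (hsr : s ≤ r)
    (hx : x ∈ cube c r) :
    1 + s / ρ x ≤ 2 * (C₀ * d ^ N₀) * (1 + r / ρ c) ^ (N₀ + 1) := by
  have h1 := h.le_mul_of_mem_cube hd hρ hr hx
  obtain ⟨hC, hN, -⟩ := h
  have hd1 : (1 : ℝ) ≤ d := by exact_mod_cast hd
  have hc := hρ c
  have hx := hρ x
  have hrc : 0 < r / ρ c := by positivity
  set R := 1 + r / ρ c with hR
  have hR1 : 1 ≤ R := by linarith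
  have hX : 1 ≤ C₀ * d ^ N₀ := one_le_mul_of_one_le_of_one_le hC (Real.one_le_rpow hd1 hN.le)
  have hXR : 1 ≤ C₀ * d ^ N₀ * R ^ (N₀ + 1) :=
    one_le_mul_of_one_le_of_one_le hX (Real.one_le_rpow hR1 (by linarith))
  have h2 : s / ρ x ≤ C₀ * d ^ N₀ * R ^ (N₀ + 1) := by
    rw [div_le_iff₀ hx, Real.rpow_add (by linarith), Real.rpow_one]
    calc s ≤ r / ρ c * ρ c := by rw [div_mul_cancel₀ _ hc.ne']; exact hsr
      _ ≤ R * (C₀ * d ^ N₀ * R ^ N₀ * ρ x) := by gcongr; linarith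
      _ = _ := by ring
  linarith

theorem MemBLO.lintegral_lowerOsc_ne_top (hρ : ∀ x, 0 < ρ x) (hf : MemBLO ρ θ f) (c : Eu) {r : ℝ}
    (hr : 0 < r) : ∫⁻ x in cube c r, lowerOsc f (cube c r) x ≠ ∞ :=
  ne_top_of_le_ne_top (ENNReal.mul_ne_top (ENNReal.mul_ne_top hf.2.ne ENNReal.ofReal_ne_top)
    (volume_cube_ne_top c r)) (lintegral_lowerOsc_le hρ f θ c hr)

theorem MemBLO.volume_level_set_le (hd : 0 < d) (hρ : ∀ x, 0 < ρ x) (hθ : 0 < θ)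
    (hslow : SlowVariation ρ C₀ N₀) (hf : MemBLO ρ θ f) {ℓ : ℝ} (hℓ : 0 < ℓ)
    (hfℓ : bloConst ρ θ f ≤ ENNReal.ofReal ℓ) (c : Eu) {r : ℝ} (hr : 0 < r) {m : ℝ}
    (hm : essInf (fun y => (f y : EReal)) (volume.restrict (cube c r)) = m) (k : ℕ) :
    volume {y | y ∈ hcube c r ∧ m + k * (2 ^ (d + 1) * (ℓ * ((2 * (C₀ * d ^ N₀)) ^ θ *
      (1 + r / ρ c) ^ ((N₀ + 1) * θ)))) < f y} ≤ (2 : ℝ≥0∞)⁻¹ ^ k * volume (hcube c r) := by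
  have hc := hρ c
  have hd1 : (1 : ℝ) ≤ d := by exact_mod_cast hd
  obtain ⟨hC, hN, -⟩ := id hslow
  have hC' : 0 < C₀ := by linarith
  have hrc : 0 < r / ρ c := by positivity
  -- Membership in BLO makes all essential infima over cubes real, so `toReal` never returns its
  -- default value here.
  have := volume_lowerOsc_gt_le hd hf.1.aestronglyMeasurable.aemeasurable
    (L := ℓ * ((2 * (C₀ * d ^ N₀)) ^ θ * (1 + r / ρ c) ^ ((N₀ + 1) * θ))) (by positivity)
    (c := c) (r := r)
    (m := fun x s => (essInf (fun y => (f y : EReal)) (volume.restrict (cube x s))).toReal)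
    ?_ k c r hr subset_rfl
  · simpa only [hm, EReal.toReal_coe] using this
  · intro x s hs hsub
    rw [restrict_hcube]
    obtain ⟨m', hm', hae⟩ := exists_essInf_eq_coe (volume_cube_ne_zero x hs)
      (hf.lintegral_lowerOsc_ne_top hρ x hs)
    have hx : x ∈ cube c r := hcube_subset_cube c r (hsub fun i => by constructor <;> linarith)
    have hsr : s ≤ r := by
      have h2 := measure_mono (μ := volume) hsub
      rw [volume_hcube, volume_hcube] at h2
      have h3 := (ENNReal.pow_le_pow_left_iff hd.ne').1 h2
      exact (ENNReal.ofReal_le_ofReal_iff hr.le).1 h3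
    have hlow := lintegral_lowerOsc_le hρ f θ x hs
    simp only [lowerOsc_eq_ofReal hm'] at hlow
    simp only [hm', EReal.toReal_coe]
    refine ⟨hae, hlow.trans ?_⟩
    rw [volume_hcube, volume_cube, ENNReal.ofReal_mul hℓ.le]
    gcongr
    have hxp := hρ x
    calc (1 + s / ρ x) ^ θ ≤ (2 * (C₀ * d ^ N₀) * (1 + r / ρ c) ^ (N₀ + 1)) ^ θ :=
          Real.rpow_le_rpow (by positivity) (hslow.one_add_div_le hd hρ hr hsr hx) hθ.le
      _ = _ := by
          rw [Real.mul_rpow (by positivity) (by positivity), ← Real.rpow_mul (by positivity)]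

theorem WeightComparison.weightPow_le (h : WeightComparison ρ ω q δ η K) {c : Eu} {r : ℝ}
    (hr : 0 < r) (h0 : weightPow ω q (cube c r) ≠ 0) (ht : weightPow ω q (cube c r) ≠ ∞)
    {E : Set Eu} (hE : MeasurableSet E) (hEQ : E ⊆ cube c r) :
    weightPow ω q E ≤ ENNReal.ofReal K * (volume E / volume (cube c r)) ^ δ *
      ENNReal.ofReal ((1 + r / ρ c) ^ η) * weightPow ω q (cube c r) :=
  (ENNReal.div_le_iff h0 ht).1 (h.2.2.2.2 c r hr E hE hEQ)

/-- The constant in the unweighted-to-weighted bound for the lower oscillation. -/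
noncomputable def forwardConst (d : ℕ) (p q θ₁ θ₂ C₀ N₀ δ K : ℝ) : ℝ :=
  2 ^ (d + 1) * (2 * (C₀ * d ^ N₀)) ^ θ₁ *
    ((∑' k : ℕ, ((k : ℝ) + 1) ^ q * ((1 / 2) ^ δ) ^ k) * K) ^ (1 / q) * cubeFactor d p q θ₂

theorem forwardConst_sum_pos {q δ : ℝ} (hδ : 0 < δ) :
    0 < ∑' k : ℕ, ((k : ℝ) + 1) ^ q * ((1 / 2 : ℝ) ^ δ) ^ k := by
  refine (summable_rpow_mul_geometric (by positivity)
    (Real.rpow_lt_one (by norm_num) (by norm_num) hδ)).tsum_pos (fun k => by positivity) 0 ?_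
  simp

theorem lintegral_lowerOsc_rpow_le (hd : 0 < d) (hρ : ∀ x, 0 < ρ x) (hq : 0 < q) (hθ : 0 < θ)
    (hω : IsWeight ω) (hslow : SlowVariation ρ C₀ N₀) (hcomp : WeightComparison ρ ω q δ η K)
    (hf : MemBLO ρ θ f) {ℓ : ℝ} (hℓ : 0 < ℓ) (hfℓ : bloConst ρ θ f ≤ ENNReal.ofReal ℓ)
    (c : Eu) {r : ℝ} (hr : 0 < r) (h0 : weightPow ω q (cube c r) ≠ 0)
    (ht : weightPow ω q (cube c r) ≠ ∞) :
    ∫⁻ x in cube c r, lowerOsc f (cube c r) x ^ q * ENNReal.ofReal (ω x) ^ q ≤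
      ENNReal.ofReal ((2 ^ (d + 1) * (ℓ * ((2 * (C₀ * d ^ N₀)) ^ θ *
        (1 + r / ρ c) ^ ((N₀ + 1) * θ)))) ^ q *
          ∑' k : ℕ, ((k : ℝ) + 1) ^ q * ((1 / 2) ^ δ) ^ k) *
        (ENNReal.ofReal K * ENNReal.ofReal ((1 + r / ρ c) ^ η) * weightPow ω q (cube c r)) := by
  have hc := hρ c
  have hd1 : (1 : ℝ) ≤ d := by exact_mod_cast hd
  obtain ⟨hC, hN, -⟩ := id hslow
  obtain ⟨hδ0, hδ1, -, hK, -⟩ := id hcomp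
  have hC' : 0 < C₀ := by linarith
  have hrc : 0 < r / ρ c := by positivity
  obtain ⟨m, hm, -⟩ := exists_essInf_eq_coe (volume_cube_ne_zero c hr)
    (hf.lintegral_lowerOsc_ne_top hρ c hr)
  have hJN := hf.volume_level_set_le hd hρ hθ hslow hℓ hfℓ c hr hm
  set Λ : ℝ := 2 ^ (d + 1) * (ℓ * ((2 * (C₀ * d ^ N₀)) ^ θ * (1 + r / ρ c) ^ ((N₀ + 1) * θ)))
    with hΛ
  have hΛpos : 0 < Λ := by positivity
  simp only [lowerOsc_eq_ofReal hm]
  rw [← restrict_hcube]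
  set E : ℕ → Set Eu := fun k => {y | y ∈ hcube c r ∧ m + k * Λ < f y} with hE
  -- As f is only almost everywhere measurable, the level sets are replaced by measurable hulls.
  -- These are cut back to the cube because (b) concerns measurable subsets of it.
  refine lintegral_rpow_le_of_level_sets (hω.aemeasurable.pow_const q) (measurableSet_hcube c r)
    (F := fun k => toMeasurable volume (E k) ∩ cube c r)
    (fun k => (measurableSet_toMeasurable _ _).inter (measurableSet_cube c r)) hΛpos hq
    (by positivity) (Real.rpow_lt_one (by norm_num) (by norm_num) hδ0) ?_ ?_
  · intro k y hy hky
    exact ⟨subset_toMeasurable _ _ ⟨hy, by linarith⟩, hcube_subset_cube c r hy⟩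
  · intro k
    refine (hcomp.weightPow_le hr h0 ht
      ((measurableSet_toMeasurable _ _).inter (measurableSet_cube c r)) inter_subset_right).trans ?_
    have hvol : volume (toMeasurable volume (E k) ∩ cube c r) / volume (cube c r) ≤
        ENNReal.ofReal ((1 / 2) ^ k) := by
      refine ENNReal.div_le_of_le_mul ((measure_mono inter_subset_left).trans ?_)
      rw [measure_toMeasurable]
      refine (hJN k).trans (le_of_eq ?_)
      rw [volume_hcube, volume_cube, ENNReal.ofReal_pow (by norm_num), one_div,
        ENNReal.ofReal_inv_of_pos (by norm_num), ENNReal.ofReal_ofNat]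
    calc _ ≤ ENNReal.ofReal K * ENNReal.ofReal ((1 / 2) ^ k) ^ δ *
          ENNReal.ofReal ((1 + r / ρ c) ^ η) * weightPow ω q (cube c r) := by gcongr
      _ = _ := by
          rw [ENNReal.ofReal_rpow_of_nonneg (by positivity) hδ0.le, ← Real.rpow_natCast,
            ← Real.rpow_natCast, ← Real.rpow_mul (by norm_num), ← Real.rpow_mul (by norm_num),
            mul_comm δ]
          ring

/-- The norm is replaced by a strictly positive majorant ℓ because the John–Nirenberg step size must
be positive. -/
theorem MemApq.weightedOsc_le_of_bloConst_le {θ₁ θ₂ : ℝ} (hd : 0 < d) (hρ : ∀ x, 0 < ρ x)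
    (hp : 1 ≤ p) (hpq : p < q) (hθ₁ : 0 < θ₁) (hθ₂ : 0 < θ₂) (h : MemApq ρ θ₂ p q ω)
    (hslow : SlowVariation ρ C₀ N₀) (hcomp : WeightComparison ρ ω q δ η K)
    (hf : MemBLO ρ θ₁ f) {ℓ : ℝ} (hℓ : 0 < ℓ) (hfℓ : bloConst ρ θ₁ f ≤ ENNReal.ofReal ℓ)
    (c : Eu) {r : ℝ} (hr : 0 < r) :
    weightedOsc p q ω f (cube c r) ≤ ENNReal.ofReal (forwardConst d p q θ₁ θ₂ C₀ N₀ δ K) *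
      apqConst ρ θ₂ p q ω * ENNReal.ofReal ((1 + r / ρ c) ^ ((N₀ + 1) * θ₁ + θ₂ + η / q)) *
        ENNReal.ofReal ℓ := by
  have hq : 0 < q := by linarith
  have hp0 : 0 < p := by linarith
  have hc := hρ c
  have hd1 : (1 : ℝ) ≤ d := by exact_mod_cast hd
  obtain ⟨hC, hN, -⟩ := id hslow
  obtain ⟨hδ0, hδ1, -, hK, -⟩ := id hcomp
  have hC' : 0 < C₀ := by linarith
  have hrc : 0 < r / ρ c := by positivity
  have hcf := cubeFactor_pos hd p q θ₂
  set Q := cube c r with hQ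
  have hQ0 : volume Q ≠ 0 := volume_cube_ne_zero c hr
  have hQt : volume Q ≠ ∞ := volume_cube_ne_top c r
  have hWt : weightPow ω q Q ≠ ∞ := h.weightPow_cube_ne_top hd hρ hp hq c hr
  have hW0 : weightPow ω q Q ≠ 0 := h.weightPow_ne_zero hρ hp hq hq hQ0
  have hI := lintegral_lowerOsc_rpow_le hd hρ hq hθ₁ h.1 hslow hcomp hf hℓ hfℓ c hr hW0 hWt
  have hS := forwardConst_sum_pos (q := q) hδ0
  set S := ∑' k : ℕ, ((k : ℝ) + 1) ^ q * ((1 / 2 : ℝ) ^ δ) ^ k with hSdef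
  set R := 1 + r / ρ c with hR
  have hRpos : 0 < R := by linarith
  set B : ℝ := 2 ^ (d + 1) * (2 * (C₀ * d ^ N₀)) ^ θ₁ * (S * K) ^ (1 / q) with hB
  have hBpos : 0 < B := by positivity
  have hJ : (∫⁻ x in Q, lowerOsc f Q x ^ q * ENNReal.ofReal (ω x) ^ q) ^ (1 / q) ≤
      ENNReal.ofReal (B * ℓ * (R ^ ((N₀ + 1) * θ₁) * R ^ (η / q))) *
        weightPow ω q Q ^ (1 / q) := by
    refine (ENNReal.rpow_le_rpow hI (by positivity)).trans (le_of_eq ?_)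
    rw [← ENNReal.ofReal_mul hK.le, ← mul_assoc, ← ENNReal.ofReal_mul (by positivity),
      ENNReal.mul_rpow_of_nonneg _ _ (by positivity),
      ENNReal.ofReal_rpow_of_nonneg (by positivity) (by positivity)]
    congr 2
    set X := (2 * (C₀ * d ^ N₀)) ^ θ₁ with hX
    have hXpos : 0 < X := by positivity
    rw [show (2 ^ (d + 1) * (ℓ * (X * R ^ ((N₀ + 1) * θ₁)))) ^ q * S * (K * R ^ η) =
      (2 ^ (d + 1) * (ℓ * (X * R ^ ((N₀ + 1) * θ₁)))) ^ q * ((S * K) * R ^ η) by ring,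
      Real.mul_rpow (by positivity) (by positivity), ← Real.rpow_mul (by positivity),
      mul_one_div_cancel hq.ne', Real.rpow_one, Real.mul_rpow (by positivity) (by positivity),
      ← Real.rpow_mul hRpos.le, mul_one_div, hB]
    ring
  have h1 := h.setLIntegral_mul_le hd hρ hp hq hθ₂ c hr (subset_refl Q)
    (G := fun _ => 1) aemeasurable_const
  simp only [one_mul, setLIntegral_one] at h1
  -- Hölder with G = 1 yields the lower bound for ω^p(Q)^{1/p}; this is where [ω] and the exponent
  -- θ₂ enter.
  have h2 : volume Q * (volume Q ^ (1 / p - 1 / q) * weightPow ω q Q ^ (1 / q)) ≤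
      volume Q * (weightPow ω p Q ^ (1 / p) * (ENNReal.ofReal (cubeFactor d p q θ₂) *
        apqConst ρ θ₂ p q ω * ENNReal.ofReal (R ^ θ₂))) := by
    calc _ = volume Q ^ (1 / p - 1 / q) * (volume Q * weightPow ω q Q ^ (1 / q)) := by ring
      _ ≤ volume Q ^ (1 / p - 1 / q) * (weightPow ω p Q ^ (1 / p) *
          (volume Q ^ (1 - 1 / p + 1 / q) * ENNReal.ofReal (cubeFactor d p q θ₂) *
          apqConst ρ θ₂ p q ω * ENNReal.ofReal (R ^ θ₂))) := mul_le_mul_right h1 _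
      _ = (volume Q ^ (1 / p - 1 / q) * volume Q ^ (1 - 1 / p + 1 / q)) *
          (weightPow ω p Q ^ (1 / p) * (ENNReal.ofReal (cubeFactor d p q θ₂) *
          apqConst ρ θ₂ p q ω * ENNReal.ofReal (R ^ θ₂))) := by ring
      _ = _ := by
          rw [← ENNReal.rpow_add _ _ hQ0 hQt]
          simp
  have h3 := (ENNReal.mul_le_mul_iff_right hQ0 hQt).1 h2
  rw [weightedOsc, ← ENNReal.mul_div_right_comm]
  refine ENNReal.div_le_of_le_mul ?_
  calc _ ≤ volume Q ^ (1 / p - 1 / q) * (ENNReal.ofReal (B * ℓ *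
        (R ^ ((N₀ + 1) * θ₁) * R ^ (η / q))) * weightPow ω q Q ^ (1 / q)) :=
        mul_le_mul_right hJ _
    _ = ENNReal.ofReal (B * ℓ * (R ^ ((N₀ + 1) * θ₁) * R ^ (η / q))) *
        (volume Q ^ (1 / p - 1 / q) * weightPow ω q Q ^ (1 / q)) := by ring
    _ ≤ ENNReal.ofReal (B * ℓ * (R ^ ((N₀ + 1) * θ₁) * R ^ (η / q))) *
        (weightPow ω p Q ^ (1 / p) * (ENNReal.ofReal (cubeFactor d p q θ₂) *
        apqConst ρ θ₂ p q ω * ENNReal.ofReal (R ^ θ₂))) := mul_le_mul_right h3 _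
    _ = (ENNReal.ofReal (B * ℓ * (R ^ ((N₀ + 1) * θ₁) * R ^ (η / q))) *
        ENNReal.ofReal (cubeFactor d p q θ₂) * ENNReal.ofReal (R ^ θ₂)) *
          apqConst ρ θ₂ p q ω * weightPow ω p Q ^ (1 / p) := by ring
    _ = (ENNReal.ofReal (forwardConst d p q θ₁ θ₂ C₀ N₀ δ K) *
        ENNReal.ofReal (R ^ ((N₀ + 1) * θ₁ + θ₂ + η / q)) * ENNReal.ofReal ℓ) *
          apqConst ρ θ₂ p q ω * weightPow ω p Q ^ (1 / p) := by
        congr 2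
        rw [← ENNReal.ofReal_mul (by positivity), ← ENNReal.ofReal_mul (by positivity),
          ← ENNReal.ofReal_mul (by unfold forwardConst; positivity),
          ← ENNReal.ofReal_mul (by unfold forwardConst; positivity)]
        congr 1
        rw [Real.rpow_add hRpos, Real.rpow_add hRpos, forwardConst, ← hSdef, hB]
        ring
    _ = _ := by ring

/-- Apply the previous bound with ℓ = ‖f‖ + ε and let ε → 0; this includes the case ‖f‖ = 0. -/
theorem MemApq.weightedOsc_le {θ₁ θ₂ : ℝ} (hd : 0 < d) (hρ : ∀ x, 0 < ρ x)
    (hp : 1 ≤ p) (hpq : p < q) (hθ₁ : 0 < θ₁) (hθ₂ : 0 < θ₂) (h : MemApq ρ θ₂ p q ω)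
    (hslow : SlowVariation ρ C₀ N₀) (hcomp : WeightComparison ρ ω q δ η K)
    (hf : MemBLO ρ θ₁ f) (c : Eu) {r : ℝ} (hr : 0 < r) :
    weightedOsc p q ω f (cube c r) ≤ ENNReal.ofReal (forwardConst d p q θ₁ θ₂ C₀ N₀ δ K) *
      apqConst ρ θ₂ p q ω * ENNReal.ofReal ((1 + r / ρ c) ^ ((N₀ + 1) * θ₁ + θ₂ + η / q)) *
        bloConst ρ θ₁ f := by
  set b := (bloConst ρ θ₁ f).toReal with hb
  have hbE : bloConst ρ θ₁ f = ENNReal.ofReal b := (ENNReal.ofReal_toReal hf.2.ne).symm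
  set Z := ENNReal.ofReal (forwardConst d p q θ₁ θ₂ C₀ N₀ δ K) *
      apqConst ρ θ₂ p q ω * ENNReal.ofReal ((1 + r / ρ c) ^ ((N₀ + 1) * θ₁ + θ₂ + η / q)) with hZ
  have hZt : Z ≠ ∞ := ENNReal.mul_ne_top (ENNReal.mul_ne_top ENNReal.ofReal_ne_top h.2.ne)
    ENNReal.ofReal_ne_top
  have hcont : Continuous fun ε : ℝ => Z * ENNReal.ofReal (b + ε) :=
    (ENNReal.continuous_const_mul hZt).comp
      (ENNReal.continuous_ofReal.comp (continuous_const.add continuous_id))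
  have hlim : Tendsto (fun ε : ℝ => Z * ENNReal.ofReal (b + ε)) (𝓝[>] 0)
      (𝓝 (Z * ENNReal.ofReal b)) := by
    have := (hcont.tendsto 0).mono_left (nhdsWithin_le_nhds (s := Ioi (0 : ℝ)))
    rwa [add_zero] at this
  rw [hbE]
  refine ge_of_tendsto hlim ?_
  filter_upwards [self_mem_nhdsWithin] with ε hε
  have hε : 0 < ε := hε
  have hb0 : 0 ≤ b := ENNReal.toReal_nonneg
  exact h.weightedOsc_le_of_bloConst_le hd hρ hp hpq hθ₁ hθ₂ hslow hcomp hf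
    (by positivity) (hbE.le.trans (ENNReal.ofReal_le_ofReal (by linarith))) c hr

end JohnNirenberg

end SchrodingerBLO

theorem mainTheorem6 (d : ℕ) (hd : 3 ≤ d) (p q θ₁ θ₂ : ℝ) (hp : 1 ≤ p) (hpq : p < q)
    (hθ₁ : 0 < θ₁) (hθ₂ : 0 < θ₂) :
    -- the constants `C₀, N₀` of the critical radius function exist
    (∀ V : EuclideanSpace ℝ (Fin d) → ℝ, SchrodingerBLO.IsPotential V →
      ∃ C₀ N₀ : ℝ, SchrodingerBLO.SlowVariation (SchrodingerBLO.criticalRadius V) C₀ N₀) ∧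
    -- the exponent `η` attached to the weight `ω^q` exists
    (∀ V ω : EuclideanSpace ℝ (Fin d) → ℝ, SchrodingerBLO.IsPotential V →
      SchrodingerBLO.MemApq (SchrodingerBLO.criticalRadius V) θ₂ p q ω →
      ∃ δ η K : ℝ,
        SchrodingerBLO.WeightComparison (SchrodingerBLO.criticalRadius V) ω q δ η K) ∧
    -- the forward bound, with a constant uniform in `V`, `ω`, `f` and the cube
    (∀ C₀ N₀ δ η K : ℝ, ∃ C : ℝ, 0 < C ∧
      ∀ V ω f : EuclideanSpace ℝ (Fin d) → ℝ, SchrodingerBLO.IsPotential V →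
        SchrodingerBLO.MemApq (SchrodingerBLO.criticalRadius V) θ₂ p q ω →
        SchrodingerBLO.SlowVariation (SchrodingerBLO.criticalRadius V) C₀ N₀ →
        SchrodingerBLO.WeightComparison (SchrodingerBLO.criticalRadius V) ω q δ η K →
        SchrodingerBLO.MemBLO (SchrodingerBLO.criticalRadius V) θ₁ f →
        ∀ (x₀ : EuclideanSpace ℝ (Fin d)) (r : ℝ), 0 < r →
          SchrodingerBLO.weightedOsc p q ω f (SchrodingerBLO.cube x₀ r) ≤
            ENNReal.ofReal C *
              SchrodingerBLO.apqConst (SchrodingerBLO.criticalRadius V) θ₂ p q ω *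
              ENNReal.ofReal ((1 + r / SchrodingerBLO.criticalRadius V x₀) ^
                ((N₀ + 1) * θ₁ + θ₂ + η / q)) *
              SchrodingerBLO.bloConst (SchrodingerBLO.criticalRadius V) θ₁ f) ∧
    -- the converse; the new constant `C'` may depend on `C` and on a bound `M` for `[ω]`
    (∀ C M : ℝ, 0 < C → ∃ C' : ℝ, 0 < C' ∧
      ∀ V ω f : EuclideanSpace ℝ (Fin d) → ℝ, SchrodingerBLO.IsPotential V →
        SchrodingerBLO.MemApq (SchrodingerBLO.criticalRadius V) θ₂ p q ω →
        SchrodingerBLO.apqConst (SchrodingerBLO.criticalRadius V) θ₂ p q ω ≤ ENNReal.ofReal M →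
        AEMeasurable f MeasureTheory.volume →
        (∀ (x₀ : EuclideanSpace ℝ (Fin d)) (r : ℝ), 0 < r →
          SchrodingerBLO.weightedOsc p q ω f (SchrodingerBLO.cube x₀ r) ≤
            ENNReal.ofReal C *
              SchrodingerBLO.apqConst (SchrodingerBLO.criticalRadius V) θ₂ p q ω *
              ENNReal.ofReal ((1 + r / SchrodingerBLO.criticalRadius V x₀) ^ (θ₁ - θ₂))) →
        SchrodingerBLO.MemBLO (SchrodingerBLO.criticalRadius V) θ₁ f ∧
          SchrodingerBLO.bloConst (SchrodingerBLO.criticalRadius V) θ₁ f ≤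
            ENNReal.ofReal C' *
              SchrodingerBLO.apqConst (SchrodingerBLO.criticalRadius V) θ₂ p q ω) := by
  have hd0 : 0 < d := by omega
  refine ⟨fun V hV => (hV.criticalRadius_pos_and_slowVariation hd).2, ?_, ?_, ?_⟩
  · intro V ω hV hω
    obtain ⟨hρ, C₀, N₀, hslow⟩ := hV.criticalRadius_pos_and_slowVariation hd
    exact hω.exists_weightComparison hd0 hρ hp hpq hθ₂ hslow
  · intro C₀ N₀ δ η K
    -- The constant is chosen before the parameters are known to be admissible, so `forwardConst`
    -- need not be positive at this point.
    refine ⟨max 1 (SchrodingerBLO.forwardConst d p q θ₁ θ₂ C₀ N₀ δ K),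
      lt_max_of_lt_left one_pos, ?_⟩
    intro V ω f hV hω hslow hcomp hf x₀ r hr
    have hρ := (hV.criticalRadius_pos_and_slowVariation hd).1
    refine (hω.weightedOsc_le hd0 hρ hp hpq hθ₁ hθ₂ hslow hcomp hf x₀ hr).trans ?_
    gcongr
    exact le_max_right _ _
  · intro C M hC
    have hcf := SchrodingerBLO.cubeFactor_pos hd0 p q θ₂
    refine ⟨C * SchrodingerBLO.cubeFactor d p q θ₂ * max M 1, by positivity, ?_⟩
    intro V ω f hV hω hM hf hosc
    have hρ := (hV.criticalRadius_pos_and_slowVariation hd).1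
    exact hω.memBLO_of_weightedOsc_le hd0 hρ hp hpq hθ₂ hf hC hM hosc
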